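/- Let $G=(V,E)$ be a finite graph whose vertices each have one of four colors, and let $S$ be a finite set of distinct points in the plane, each having one of the same four colors (not every color has to be used). $S$ is *compatible* with $G$ if, for each color, the number of points of $S$ of that color equals the number of vertices of $G$ of that color. A *4-colored point-set embedding* of $G$ on $S$ is a planar drawing of $G$ in which the vertices are mapped to distinct points of $S$, each vertex to a point of its own color, and every edge is drawn as a simple polyline; here planar means that no edge passes through a vertex other than its two end-vertices and that two distinct edges meet only at a common end-vertex. A point shared by two consecutive segments of a polyline is a *bend*, and the *curve complexity* of the embedding is the maximum number of bends along an edge. **Theorem.** Let $P$ be a 4-colored path with $n$ vertices $v_1,\dots,v_n$ in this order along $P$, let $2\le h\le n$, and suppose that there is a set $A$ of two of the four colors such that the vertices $v_1,\dots,v_h$ only have colors in $A$ and the vertices $v_{h+1},\dots,v_n$ only have colors not in $A$. Then, for every 4-colored point set $S$ compatible with $P$, $P$ has a 4-colored point-set embedding on $S$ with curve complexity at most $5$. -/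

import Mathlib

/-- The plane. Only its real vector space structure (segments) is used below. -/
abbrev Plane : Type := ℝ × ℝ

/-- The set of points covered by the polyline with the given list of corners, that is, the union
of the segments between consecutive corners. -/
def polylineSet : List Plane → Set Plane
  | [] => ∅
  | [p] => {p}
  | p :: q :: l => segment ℝ p q ∪ polylineSet (q :: l)

/-- The polyline with the given list of corners is a simple arc: no segment is degenerate, and each
segment meets the part of the polyline that follows it only in their shared corner. -/
def IsSimplePolyline : List Plane → Prop
  | [] => True
  | [_] => True
  | p :: q :: l =>
      p ≠ q ∧ segment ℝ p q ∩ polylineSet (q :: l) = {q} ∧ IsSimplePolyline (q :: l)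

/-- A planar polyline drawing of a graph. Vertices are distinct points. Every edge is a simple
polyline; `bends d` lists its bends (the points shared by consecutive segments) in order from
`d.fst` to `d.snd`, and the two orientations of an edge describe the same polyline. An edge passes
through no vertex other than its two ends, and two distinct edges meet only in the image of a
common end-vertex. -/
structure PolylineDrawing {V : Type*} (G : SimpleGraph V) where
  pos : V → Plane
  pos_injective : Function.Injective pos
  bends : G.Dart → List Plane
  bends_symm : ∀ d : G.Dart, bends d.symm = (bends d).reverse
  simple : ∀ d : G.Dart, IsSimplePolyline (pos d.fst :: (bends d ++ [pos d.snd]))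
  vertex_mem : ∀ (d : G.Dart) (w : V),
    pos w ∈ polylineSet (pos d.fst :: (bends d ++ [pos d.snd])) → w ∈ d.edge
  planar : ∀ d e : G.Dart, d.edge ≠ e.edge → ∀ x : Plane,
    x ∈ polylineSet (pos d.fst :: (bends d ++ [pos d.snd])) →
    x ∈ polylineSet (pos e.fst :: (bends e ++ [pos e.snd])) →
    ∃ w : V, w ∈ d.edge ∧ w ∈ e.edge ∧ x = pos w

/-- The curve complexity of a drawing: the maximum number of bends along an edge. -/
noncomputable def PolylineDrawing.curveComplexity {V : Type*} {G : SimpleGraph V}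
    (D : PolylineDrawing G) : ℕ∞ :=
  ⨆ d : G.Dart, ((D.bends d).length : ℕ∞)

/-- A `k`-colored point set: a finite set of (distinct) points of the plane, each of which has one
of `k` colors. -/
structure ColoredPointSet (k : ℕ) where
  points : Finset Plane
  color : points → Fin k

/-- A colored point set is compatible with a graph whose vertices are colored by `col` if every
color is given to equally many vertices and points. -/
def ColoredPointSet.IsCompatible {k : ℕ} (S : ColoredPointSet k) {V : Type*} [Fintype V]
    (col : V → Fin k) : Prop :=
  ∀ i : Fin k, (Finset.univ.filter fun v : V => col v = i).card =
    (Finset.univ.filter fun p : S.points => S.color p = i).card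

/-- The drawing `D` of a graph whose vertices are colored by `col` is a `k`-colored point-set
embedding on `S`: every vertex lies at a point of `S` of its own color. (Distinct vertices lie at
distinct points in every drawing.) -/
def PolylineDrawing.IsColoredPointSetEmbedding {V : Type*} {G : SimpleGraph V} {k : ℕ}
    (D : PolylineDrawing G) (col : V → Fin k) (S : ColoredPointSet k) : Prop :=
  ∀ v : V, ∃ hv : D.pos v ∈ S.points, S.color ⟨D.pos v, hv⟩ = col v

/-! ### Polylines -/

/-! The two parts of the path use disjoint pairs of colors, so they also use disjoint sets of
points. A linear automorphism makes all ordinates small and puts the points into columns far apart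
(`exists_normalization`); it preserves polylines and bends, so it suffices to embed after it.

Each part is drawn on one side only: the first never goes below height -2, and the second is the
mirror image of such a drawing. Near the horizontal axis each part stays close to its own columns,
so the two cannot meet there. Both are prolonged to one point of the axis to the right of all
columns, where they are joined (`exists_half_path`, `exists_two_sided_path`).

For one part, the combinatorial task is to match a two-letter word with a row of columns carrying
the same numbers of each letter. If the first column has the first letter of the word, it is
visited. Otherwise a balance argument finds an initial block of columns that can be visited in the
order last column, interior, first column, with the interior balanced again; this gives a recursive
`Arrangement` (`exists_arrangement`).

Geometrically, the path moves between columns along tents: two legs of slopes 1 and -1 with feet on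
the line at height -2. Tents over disjoint or strictly nested intervals are disjoint, so planarity
reduces to comparing intervals (`Drawable.simple`). To jump to the end of a block without covering
its first vertex, the path dips below that vertex; after the interior it dips below the last vertex
in order to get out (`Block.swap`, `Block.wrap`). At most one dip occurs between consecutive
vertices. A tent has two bends, its apex and its landing point, and a dip adds its take-off point,
so an edge has at most 2 + 1 + 2 = 5 bends. -/

theorem polylineSet_cons_cons (p q : Plane) (l : List Plane) :
    polylineSet (p :: q :: l) = segment ℝ p q ∪ polylineSet (q :: l) := rfl

theorem polylineSet_singleton (p : Plane) : polylineSet [p] = {p} := rfl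

theorem isSimplePolyline_cons_cons (p q : Plane) (l : List Plane) :
    IsSimplePolyline (p :: q :: l) ↔
      p ≠ q ∧ segment ℝ p q ∩ polylineSet (q :: l) = {q} ∧ IsSimplePolyline (q :: l) := Iff.rfl

theorem head_mem_polylineSet (p : Plane) (l : List Plane) : p ∈ polylineSet (p :: l) := by
  cases l with
  | nil => simp [polylineSet]
  | cons q l => exact Or.inl (left_mem_segment ℝ p q)

theorem polylineSet_append (l₁ : List Plane) (p : Plane) (l₂ : List Plane) :
    polylineSet (l₁ ++ p :: l₂) = polylineSet (l₁ ++ [p]) ∪ polylineSet (p :: l₂) := by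
  induction l₁ with
  | nil =>
    simp only [List.nil_append, polylineSet_singleton]
    exact (Set.union_eq_right.2 (Set.singleton_subset_iff.2 (head_mem_polylineSet p l₂))).symm
  | cons a l₁ ih =>
    cases l₁ with
    | nil =>
      simp only [List.cons_append, List.nil_append, polylineSet_cons_cons, polylineSet_singleton]
      rw [Set.union_assoc, Set.union_eq_right.2
        (Set.singleton_subset_iff.2 (head_mem_polylineSet p l₂))]
    | cons b l₁ =>
      simp only [List.cons_append, polylineSet_cons_cons] at ih ⊢
      rw [ih, Set.union_assoc]

theorem mem_polylineSet_of_append_left {l₁ l₂ : List Plane} {x : Plane} (p : Plane)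
    (h : x ∈ polylineSet (l₁ ++ [p])) : x ∈ polylineSet (l₁ ++ p :: l₂) := by
  rw [polylineSet_append]; exact Or.inl h

theorem mem_polylineSet_of_append_right {l₁ l₂ : List Plane} {x : Plane} (p : Plane)
    (h : x ∈ polylineSet (p :: l₂)) : x ∈ polylineSet (l₁ ++ p :: l₂) := by
  rw [polylineSet_append]; exact Or.inr h

theorem last_mem_polylineSet (l : List Plane) (p : Plane) : p ∈ polylineSet (l ++ [p]) :=
  mem_polylineSet_of_append_right p (by simp [polylineSet])

theorem isSimplePolyline_append (l₁ : List Plane) (p : Plane) (l₂ : List Plane) :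
    IsSimplePolyline (l₁ ++ p :: l₂) ↔
      IsSimplePolyline (l₁ ++ [p]) ∧ IsSimplePolyline (p :: l₂) ∧
        ∀ x ∈ polylineSet (l₁ ++ [p]), x ∈ polylineSet (p :: l₂) → x = p := by
  induction l₁ with
  | nil => simp [IsSimplePolyline, polylineSet]
  | cons a l₁ ih =>
    -- The corner after `a` is the head of `l₁ ++ [p]` whether or not `l₁` is empty; naming it `b`
    -- treats both cases at once.
    have key : ∀ (b : Plane) (m m' : List Plane), m' ++ [p] = b :: m →
        (IsSimplePolyline (a :: (m' ++ p :: l₂)) ↔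
        a ≠ b ∧ segment ℝ a b ∩ polylineSet (m' ++ p :: l₂) = {b} ∧
          IsSimplePolyline (m' ++ p :: l₂)) := by
      intro b m m' hm
      cases m' with
      | nil => simp at hm; obtain ⟨rfl, rfl⟩ := hm; exact Iff.rfl
      | cons c m' => simp at hm; obtain ⟨rfl, rfl⟩ := hm; exact Iff.rfl
    obtain ⟨b, m, hm⟩ : ∃ b m, l₁ ++ [p] = b :: m := by
      cases l₁ with
      | nil => exact ⟨p, [], rfl⟩
      | cons c l₁ => exact ⟨c, _, rfl⟩
    have hb : b ∈ polylineSet (l₁ ++ [p]) := by rw [hm]; exact head_mem_polylineSet b m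
    simp only [List.cons_append]
    rw [key b m l₁ hm, ih, hm, isSimplePolyline_cons_cons, polylineSet_cons_cons, ← hm,
      polylineSet_append]
    constructor
    · rintro ⟨hab, hseg, h1, h2, h3⟩
      refine ⟨⟨hab, ?_, h1⟩, h2, ?_⟩
      · ext x
        constructor
        · rintro ⟨hx, hx'⟩
          rw [← hseg]; exact ⟨hx, Or.inl hx'⟩
        · rintro rfl
          exact ⟨right_mem_segment ℝ a _, hb⟩
      · rintro x (hx | hx) hx'
        · have : x ∈ ({b} : Set Plane) := by rw [← hseg]; exact ⟨hx, Or.inr hx'⟩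
          rw [Set.mem_singleton_iff] at this
          subst this
          exact h3 _ hb hx'
        · exact h3 x hx hx'
    · rintro ⟨⟨hab, hseg, h1⟩, h2, h3⟩
      refine ⟨hab, ?_, h1, h2, fun x hx hx' => h3 x (Or.inr hx) hx'⟩
      ext x
      constructor
      · rintro ⟨hx, hx' | hx'⟩
        · rw [← hseg]; exact ⟨hx, hx'⟩
        · have := h3 x (Or.inl hx) hx'
          subst this
          rw [← hseg]; exact ⟨hx, last_mem_polylineSet _ _⟩
      · rintro rfl
        exact ⟨right_mem_segment ℝ a _, Or.inl hb⟩

theorem polylineSet_reverse (l : List Plane) : polylineSet l.reverse = polylineSet l := by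
  induction l with
  | nil => rfl
  | cons p l ih =>
    cases l with
    | nil => rfl
    | cons q l =>
      rw [List.reverse_cons, List.reverse_cons, List.append_assoc, List.singleton_append,
        polylineSet_append, ← List.reverse_cons, ih, polylineSet_cons_cons, polylineSet_cons_cons,
        polylineSet_singleton, segment_symm, Set.union_comm,
        Set.union_eq_left.2 (Set.singleton_subset_iff.2 (left_mem_segment ℝ p q))]

theorem IsSimplePolyline.reverse {l : List Plane} (h : IsSimplePolyline l) :
    IsSimplePolyline l.reverse := by
  induction l with
  | nil => trivial
  | cons p l ih =>
    cases l with
    | nil => trivial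
    | cons q l =>
      obtain ⟨h1, h2, h3⟩ := h
      rw [List.reverse_cons, List.reverse_cons, List.append_assoc, List.singleton_append,
        isSimplePolyline_append, ← List.reverse_cons, polylineSet_reverse]
      refine ⟨ih h3, ⟨h1.symm, ?_, trivial⟩, ?_⟩
      · rw [polylineSet_singleton]
        exact Set.inter_eq_right.2 (Set.singleton_subset_iff.2 (right_mem_segment ℝ q p))
      · intro x hx hx'
        rw [polylineSet_cons_cons, polylineSet_singleton, segment_symm,
          Set.union_eq_left.2 (Set.singleton_subset_iff.2 (left_mem_segment ℝ p q))] at hx'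
        have : x ∈ ({q} : Set Plane) := by rw [← h2]; exact ⟨hx', hx⟩
        exact this

theorem polylineSet_map (f : Plane →ₗ[ℝ] Plane) (l : List Plane) :
    polylineSet (l.map f) = f '' polylineSet l := by
  induction l with
  | nil => simp [polylineSet]
  | cons p l ih =>
    cases l with
    | nil => simp [polylineSet]
    | cons q l =>
      simp only [List.map_cons, polylineSet_cons_cons] at ih ⊢
      rw [ih, Set.image_union]
      congr 1
      exact (image_segment ℝ f.toAffineMap p q).symm

theorem IsSimplePolyline.map {l : List Plane} (h : IsSimplePolyline l) (f : Plane →ₗ[ℝ] Plane)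
    (hf : Function.Injective f) : IsSimplePolyline (l.map f) := by
  induction l with
  | nil => trivial
  | cons p l ih =>
    cases l with
    | nil => trivial
    | cons q l =>
      obtain ⟨h1, h2, h3⟩ := h
      refine ⟨hf.ne h1, ?_, ih h3⟩
      have := polylineSet_map f (q :: l)
      rw [List.map_cons] at this
      have hs : segment ℝ (f p) (f q) = f '' segment ℝ p q :=
        (image_segment ℝ f.toAffineMap p q).symm
      rw [this, hs, ← Set.image_inter hf, h2, Set.image_singleton]

theorem IsSimplePolyline.left {l₁ : List Plane} {p : Plane} {l₂ : List Plane}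
    (h : IsSimplePolyline (l₁ ++ p :: l₂)) : IsSimplePolyline (l₁ ++ [p]) :=
  ((isSimplePolyline_append _ _ _).1 h).1

theorem IsSimplePolyline.right {l₁ : List Plane} {p : Plane} {l₂ : List Plane}
    (h : IsSimplePolyline (l₁ ++ p :: l₂)) : IsSimplePolyline (p :: l₂) :=
  ((isSimplePolyline_append _ _ _).1 h).2.1

theorem IsSimplePolyline.ends_ne {p q : Plane} {l : List Plane}
    (h : IsSimplePolyline (p :: (l ++ [q]))) : p ≠ q := by
  rintro rfl
  obtain ⟨b, m, hm⟩ : ∃ b m, l ++ [p] = b :: m := by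
    cases l with
    | nil => exact ⟨p, [], rfl⟩
    | cons c l => exact ⟨c, _, rfl⟩
  have hp := last_mem_polylineSet l p
  rw [hm] at h hp
  obtain ⟨h1, h2, -⟩ := h
  have : p ∈ ({b} : Set Plane) := by rw [← h2]; exact ⟨left_mem_segment ℝ p b, hp⟩
  exact h1 this

/-! ### Drawings of paths from one long polyline -/

/-- The corners of the polyline that starts at `s` and runs through the edges listed in `es`, each
given by its bends and its final vertex. -/
def pathCorners (s : Plane) : List (List Plane × Plane) → List Plane
  | [] => [s]
  | e :: es => s :: (e.1 ++ pathCorners e.2 es)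

/-- The `i`-th vertex of such a polyline. -/
def pathVertex (s : Plane) (es : List (List Plane × Plane)) (i : ℕ) : Plane :=
  (s :: es.map Prod.snd).getD i 0

/-- The bends of the `i`-th edge of such a polyline. -/
def pathBends (es : List (List Plane × Plane)) (i : ℕ) : List Plane :=
  (es.map Prod.fst).getD i []

/-- The corners of the `i`-th edge of such a polyline. -/
def pathEdge (s : Plane) (es : List (List Plane × Plane)) (i : ℕ) : List Plane :=
  pathVertex s es i :: (pathBends es i ++ [pathVertex s es (i + 1)])

theorem pathCorners_eq_cons (s : Plane) (es : List (List Plane × Plane)) :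
    ∃ l, pathCorners s es = s :: l := by
  cases es with
  | nil => exact ⟨[], rfl⟩
  | cons e es => exact ⟨_, rfl⟩

theorem pathCorners_eq_concat (s : Plane) (es : List (List Plane × Plane)) :
    ∃ l, pathCorners s es = l ++ [pathVertex s es es.length] := by
  induction es generalizing s with
  | nil => exact ⟨[], rfl⟩
  | cons e es ih =>
    obtain ⟨l, hl⟩ := ih e.2
    refine ⟨s :: (e.1 ++ l), ?_⟩
    rw [pathCorners, hl]
    simp [pathVertex]

theorem pathCorners_append (s : Plane) (es : List (List Plane × Plane)) (b : List Plane)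
    (p : Plane) (es' : List (List Plane × Plane)) :
    pathCorners s (es ++ (b, p) :: es') = pathCorners s es ++ (b ++ pathCorners p es') := by
  induction es generalizing s with
  | nil => rfl
  | cons e es ih => simp [pathCorners, ih]

/-- Both halves are drawn towards their common point, so the second one has to be traversed
backwards in the final path. -/
theorem exists_reverse_path (s : Plane) (es : List (List Plane × Plane)) :
    ∃ s' es', pathCorners s' es' = (pathCorners s es).reverse ∧
      s' :: es'.map Prod.snd = (s :: es.map Prod.snd).reverse ∧
      es'.map (fun e => e.1.length) = (es.map (fun e => e.1.length)).reverse := by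
  induction es generalizing s with
  | nil => exact ⟨s, [], rfl, rfl, rfl⟩
  | cons e es ih =>
    obtain ⟨s', es', h1, h2, h3⟩ := ih e.2
    refine ⟨s', es' ++ [(e.1.reverse, s)], ?_, ?_, ?_⟩
    · rw [pathCorners_append, h1]
      simp [pathCorners]
    · rw [List.map_append, ← List.cons_append, h2]
      simp
    · rw [List.map_append, h3]
      simp

theorem pathEdge_subset (s : Plane) (es : List (List Plane × Plane)) (i : ℕ)
    (hi : i < es.length) : polylineSet (pathEdge s es i) ⊆ polylineSet (pathCorners s es) := by
  induction es generalizing s i with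
  | nil => simp at hi
  | cons e es ih =>
    obtain ⟨l, hl⟩ := pathCorners_eq_cons e.2 es
    rw [pathCorners, hl, ← List.cons_append]
    cases i with
    | zero => intro x hx; exact mem_polylineSet_of_append_left _ hx
    | succ i =>
      intro x hx
      refine mem_polylineSet_of_append_right _ ?_
      rw [← hl]
      exact ih e.2 i (by simpa using hi) hx

theorem pathEdge_simple {s : Plane} {es : List (List Plane × Plane)}
    (h : IsSimplePolyline (pathCorners s es)) (i : ℕ) (hi : i < es.length) :
    IsSimplePolyline (pathEdge s es i) := by
  induction es generalizing s i with
  | nil => simp at hi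
  | cons e es ih =>
    obtain ⟨l, hl⟩ := pathCorners_eq_cons e.2 es
    rw [pathCorners, hl, ← List.cons_append] at h
    cases i with
    | zero => exact h.left
    | succ i =>
      have := h.right
      rw [← hl] at this
      exact ih this i (by simpa using hi)

/-- Cutting the polyline at the end of its first edge leaves only that vertex as a possible
intersection with later edges. -/
theorem pathEdge_inter {s : Plane} {es : List (List Plane × Plane)}
    (h : IsSimplePolyline (pathCorners s es)) (i j : ℕ) (hij : i < j) (hj : j < es.length)
    (x : Plane) (hx : x ∈ polylineSet (pathEdge s es i)) (hx' : x ∈ polylineSet (pathEdge s es j)) :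
    j = i + 1 ∧ x = pathVertex s es j := by
  induction es generalizing s i j x with
  | nil => simp at hj
  | cons e es ih =>
    obtain ⟨l, hl⟩ := pathCorners_eq_cons e.2 es
    have h' := h
    rw [pathCorners, hl, ← List.cons_append, isSimplePolyline_append, ← hl] at h'
    obtain ⟨-, h2, h3⟩ := h'
    obtain ⟨j, rfl⟩ : ∃ j', j = j' + 1 := ⟨j - 1, by omega⟩
    have hj' : j < es.length := by simpa using hj
    cases i with
    | succ i =>
      have := ih h2 i j (by omega) hj' x hx hx'
      exact ⟨by omega, this.2⟩
    | zero =>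
      have hxe : x = e.2 := h3 x hx (pathEdge_subset e.2 es j hj' hx')
      subst hxe
      rcases Nat.eq_zero_or_pos j with rfl | hj0
      · exact ⟨rfl, rfl⟩
      · exfalso
        -- The vertex `e.2` starts edge 0 of the tail; if it also lay on a later edge, it would be
        -- the other end of edge 0 too.
        have h0 := ih h2 0 j hj0 hj' e.2 (head_mem_polylineSet _ _) hx'
        obtain ⟨rfl, h0⟩ := h0
        exact (pathEdge_simple h2 0 (by omega)).ends_ne h0

theorem pathVertex_ne {s : Plane} {es : List (List Plane × Plane)}
    (h : IsSimplePolyline (pathCorners s es)) (i j : ℕ) (hij : i < j) (hj : j ≤ es.length) :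
    pathVertex s es i ≠ pathVertex s es j := by
  intro he
  obtain ⟨j, rfl⟩ : ∃ j', j = j' + 1 := ⟨j - 1, by omega⟩
  have hi : IsSimplePolyline (pathEdge s es i) := pathEdge_simple h i (by omega)
  rcases Nat.lt_or_ge i j with hlt | hge
  · have := pathEdge_inter h i j hlt (by omega) (pathVertex s es i) (head_mem_polylineSet _ _)
      (by rw [he]; exact last_mem_polylineSet (_ :: _) _)
    obtain ⟨rfl, h2⟩ := this
    exact hi.ends_ne h2
  · obtain rfl : i = j := by omega
    exact hi.ends_ne he

theorem pathVertex_mem_pathEdge {s : Plane} {es : List (List Plane × Plane)}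
    (h : IsSimplePolyline (pathCorners s es)) (i k : ℕ) (hi : i < es.length) (hk : k ≤ es.length)
    (hm : pathVertex s es k ∈ polylineSet (pathEdge s es i)) : k = i ∨ k = i + 1 := by
  by_contra! hne
  rcases Nat.lt_or_ge k i with hlt | hge
  · have := pathEdge_inter h k i hlt hi _ (head_mem_polylineSet _ _) hm
    exact pathVertex_ne h k i hlt (by omega) this.2
  · obtain ⟨k, rfl⟩ : ∃ k', k = k' + 1 := ⟨k - 1, by omega⟩
    have := pathEdge_inter h i k (by omega) (by omega) _ hm (last_mem_polylineSet (_ :: _) _)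
    exact pathVertex_ne h k (k + 1) (by omega) (by omega) this.2.symm

/-- All planarity conditions for a path follow from simplicity of the one concatenated polyline.
Darts against the order of the path take the reversed list of bends. -/
theorem exists_drawing_of_path {n : ℕ} (s : Plane) (es : List (List Plane × Plane))
    (hn : es.length + 1 = n) (h : IsSimplePolyline (pathCorners s es))
    (hb : ∀ e ∈ es, e.1.length ≤ 5) :
    ∃ D : PolylineDrawing (SimpleGraph.pathGraph n),
      (∀ i, D.pos i = pathVertex s es i) ∧ D.curveComplexity ≤ 5 := by
  let B : (SimpleGraph.pathGraph n).Dart → List Plane := fun d =>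
    if d.fst < d.snd then pathBends es d.fst else (pathBends es d.snd).reverse
  have hB : ∀ d : (SimpleGraph.pathGraph n).Dart, ∃ i : ℕ, i < es.length ∧
      (((d.fst : ℕ) = i ∧ (d.snd : ℕ) = i + 1 ∧
        pathVertex s es d.fst :: (B d ++ [pathVertex s es d.snd]) = pathEdge s es i) ∨
      ((d.fst : ℕ) = i + 1 ∧ (d.snd : ℕ) = i ∧
        pathVertex s es d.fst :: (B d ++ [pathVertex s es d.snd]) = (pathEdge s es i).reverse)) := by
    intro d
    rcases SimpleGraph.pathGraph_adj.1 d.adj with h1 | h1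
    · refine ⟨d.fst, by have := d.snd.2; omega, Or.inl ⟨rfl, h1.symm, ?_⟩⟩
      have : d.fst < d.snd := by rw [Fin.lt_def]; omega
      simp [B, this, pathEdge, h1]
    · refine ⟨d.snd, by have := d.fst.2; omega, Or.inr ⟨h1.symm, rfl, ?_⟩⟩
      have : ¬ d.fst < d.snd := by rw [Fin.lt_def]; omega
      simp [B, this, pathEdge, h1]
  have hset : ∀ d : (SimpleGraph.pathGraph n).Dart, ∃ i : ℕ, i < es.length ∧
      (∀ w : Fin n, w ∈ d.edge ↔ ((w : ℕ) = i ∨ (w : ℕ) = i + 1)) ∧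
      polylineSet (pathVertex s es d.fst :: (B d ++ [pathVertex s es d.snd])) =
        polylineSet (pathEdge s es i) ∧
      IsSimplePolyline (pathVertex s es d.fst :: (B d ++ [pathVertex s es d.snd])) := by
    intro d
    have hmem : ∀ w : Fin n, w ∈ d.edge ↔ (w = d.fst ∨ w = d.snd) := by
      intro w; rw [SimpleGraph.Dart.edge]; simp [Sym2.mem_iff]
    obtain ⟨i, hi, ⟨h1, h2, h3⟩ | ⟨h1, h2, h3⟩⟩ := hB d
    · refine ⟨i, hi, fun w => ?_, by rw [h3], by rw [h3]; exact pathEdge_simple h i hi⟩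
      rw [hmem, Fin.ext_iff, Fin.ext_iff, h1, h2]
    · refine ⟨i, hi, fun w => ?_, by rw [h3, polylineSet_reverse],
        by rw [h3]; exact (pathEdge_simple h i hi).reverse⟩
      rw [hmem, Fin.ext_iff, Fin.ext_iff, h1, h2, or_comm]
  refine ⟨{ pos := fun i => pathVertex s es i
            pos_injective := ?_
            bends := B
            bends_symm := ?_
            simple := fun d => (hset d).choose_spec.2.2.2
            vertex_mem := ?_
            planar := ?_ }, fun _ => rfl, ?_⟩
  · intro i j hij
    by_contra hne
    have hi := i.2
    have hj := j.2
    rcases Nat.lt_or_gt_of_ne (fun h => hne (Fin.ext h)) with hlt | hlt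
    · exact pathVertex_ne h i j hlt (by omega) hij
    · exact pathVertex_ne h j i hlt (by omega) hij.symm
  · intro d
    have hne : (d.fst : ℕ) ≠ d.snd := fun h => d.adj.ne (Fin.ext h)
    by_cases hd : d.fst < d.snd
    · have : ¬ d.snd < d.fst := not_lt.2 hd.le
      simp [B, hd, this]
    · have : d.snd < d.fst := by rw [Fin.lt_def] at hd ⊢; omega
      simp [B, hd, this]
  · intro d w hw
    obtain ⟨i, hi, h1, h2, -⟩ := hset d
    rw [h2] at hw
    rw [h1]
    exact pathVertex_mem_pathEdge h i w hi (by have := w.2; omega) hw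
  · intro d e hde x hx hx'
    obtain ⟨i, hi, h1, h2, -⟩ := hset d
    obtain ⟨j, hj, h1', h2', -⟩ := hset e
    rw [h2] at hx
    rw [h2'] at hx'
    have hij : i ≠ j := by
      rintro rfl
      exact hde (Sym2.ext fun w => by rw [h1, h1'])
    rcases Nat.lt_or_gt_of_ne hij with hlt | hlt
    · obtain ⟨rfl, h4⟩ := pathEdge_inter h i j hlt hj x hx hx'
      exact ⟨⟨i + 1, by omega⟩, (h1 _).2 (Or.inr rfl), (h1' _).2 (Or.inl rfl), h4⟩
    · obtain ⟨rfl, h4⟩ := pathEdge_inter h j i hlt hi x hx' hx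
      exact ⟨⟨j + 1, by omega⟩, (h1 _).2 (Or.inl rfl), (h1' _).2 (Or.inr rfl), h4⟩
  · refine iSup_le fun d => ?_
    have hle : ∀ i, (pathBends es i).length ≤ 5 := by
      intro i
      rw [pathBends, List.getD_eq_getElem?_getD]
      by_cases hi : i < es.length
      · simp [hi]; exact hb _ (List.getElem_mem hi)
      · simp [hi]
    change (((B d).length : ℕ) : ℕ∞) ≤ 5
    have : (B d).length ≤ 5 := by
      by_cases hd : d.fst < d.snd
      · simpa [B, hd] using hle _
      · simpa [B, hd] using hle _
    exact_mod_cast this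

/-! ### Matching a two-letter word with a rearrangement of it -/

/-- A way to visit a row of consecutive columns: either the first column is visited first, or an
initial block of at least two columns is visited from its last column, through its interior, to its
first column; then the remaining columns are visited. -/
inductive Arrangement : Type
  | nil : Arrangement
  | pt (rest : Arrangement) : Arrangement
  | wrap (inner rest : Arrangement) : Arrangement

/-- The number of columns. -/
def Arrangement.size : Arrangement → ℕ
  | .nil => 0
  | .pt r => 1 + r.size
  | .wrap i r => 2 + i.size + r.size

/-- The order in which the columns `k, k + 1, …` are visited. -/
def Arrangement.order : Arrangement → ℕ → List ℕ
  | .nil, _ => []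
  | .pt r, k => k :: r.order (k + 1)
  | .wrap i r, k => (k + 1 + i.size) :: (i.order (k + 1) ++ k :: r.order (k + 2 + i.size))

theorem Arrangement.mem_order (t : Arrangement) (k i : ℕ) (hi : i ∈ t.order k) :
    k ≤ i ∧ i < k + t.size := by
  induction t generalizing k with
  | nil => simp [order] at hi
  | pt r ih =>
    simp only [order, List.mem_cons, size] at hi ⊢
    rcases hi with rfl | hi
    · omega
    · have := ih _ hi; omega
  | wrap j r ihj ihr =>
    simp only [order, List.mem_cons, List.mem_append, size] at hi ⊢
    rcases hi with rfl | hi | rfl | hi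
    · omega
    · have := ihj _ hi; omega
    · omega
    · have := ihr _ hi; omega

theorem Bool.count_eq_of_length_eq {l₁ l₂ : List Bool} (hl : l₁.length = l₂.length) (x : Bool)
    (hx : l₁.count x = l₂.count x) (a : Bool) : l₁.count a = l₂.count a := by
  have h1 := List.count_not_add_count l₁ x
  have h2 := List.count_not_add_count l₂ x
  rcases Bool.eq_or_eq_not a x with rfl | rfl
  · exact hx
  · omega

/-- Discrete intermediate value argument: the excess of `a` in the columns over `a` in the word
starts at 0, changes by at most one per position and ends at `d + 1`. When it first rises from `d`
to `d + 1`, the column carries `a` and the word does not. The general `d` serves the induction; the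
case 0 is the one applied. -/
theorem exists_first_balance (f : ℕ → Bool) (a : Bool) (w : List Bool) (k d : ℕ)
    (h : ((List.range' k w.length).map f).count a = w.count a + (d + 1)) :
    ∃ u v, w = u ++ (!a) :: v ∧ f (k + u.length) = a ∧
      ((List.range' k u.length).map f).count a = u.count a + d := by
  induction w generalizing k d with
  | nil => simp at h
  | cons x w ih =>
    simp only [List.length_cons, List.range'_succ, List.map_cons] at h
    rcases Bool.eq_or_eq_not x a with rfl | rfl
    · rcases Bool.eq_or_eq_not (f k) x with hf | hf
      · obtain ⟨u, v, h1, h2, h3⟩ := ih (k + 1) d (by rw [hf] at h; simp at h; omega)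
        refine ⟨x :: u, v, by rw [h1]; rfl, ?_, ?_⟩
        · rw [← h2]; congr 1; simp; omega
        · simp [List.range'_succ, hf, h3]; omega
      · obtain ⟨u, v, h1, h2, h3⟩ := ih (k + 1) (d + 1) (by rw [hf] at h; simp at h; omega)
        refine ⟨x :: u, v, by rw [h1]; rfl, ?_, ?_⟩
        · rw [← h2]; congr 1; simp; omega
        · simp [List.range'_succ, hf, h3]; omega
    · rcases Bool.eq_or_eq_not (f k) a with hf | hf
      · cases d with
        | zero => exact ⟨[], w, rfl, hf, rfl⟩
        | succ d =>
          obtain ⟨u, v, h1, h2, h3⟩ := ih (k + 1) d (by rw [hf] at h; simp at h; omega)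
          refine ⟨(!a) :: u, v, by rw [h1]; rfl, ?_, ?_⟩
          · rw [← h2]; congr 1; simp; omega
          · simp [List.range'_succ, hf, h3]; omega
      · obtain ⟨u, v, h1, h2, h3⟩ := ih (k + 1) d (by rw [hf] at h; simp at h; omega)
        refine ⟨(!a) :: u, v, by rw [h1]; rfl, ?_, ?_⟩
        · rw [← h2]; congr 1; simp; omega
        · simp [List.range'_succ, hf, h3]

/-- If the word starts with `x` but column `k` does not carry `x`, the later columns have one `x`
too many for the rest of the word. The first balance point writes the word as `x`, `u`, `!x`, `v`,
where the column behind the `u`-block carries `x`. That column takes the first letter, the interior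
takes `u`, column `k` takes `!x`, and `u` and `v` are both balanced. -/
theorem exists_arrangement (f : ℕ → Bool) (n : ℕ) (w : List Bool) (hn : w.length = n) (k : ℕ)
    (h : ∀ a, ((List.range' k w.length).map f).count a = w.count a) :
    ∃ t : Arrangement, t.size = w.length ∧ (t.order k).map f = w := by
  induction n using Nat.strong_induction_on generalizing w k with
  | _ n ih =>
    cases w with
    | nil => exact ⟨.nil, rfl, rfl⟩
    | cons x w =>
      simp only [List.length_cons, List.range'_succ, List.map_cons] at h hn
      rcases Bool.eq_or_eq_not (f k) x with hf | hf
      · obtain ⟨t, h1, h2⟩ := ih w.length (by omega) w rfl (k + 1) (fun a => by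
          have := h a
          rw [hf, List.count_cons, List.count_cons] at this
          omega)
        exact ⟨.pt t, by simp [Arrangement.size, h1]; omega, by simp [Arrangement.order, hf, h2]⟩
      · have hx := h x
        rw [hf] at hx
        obtain ⟨u, v, h1, h2, h3⟩ := exists_first_balance f x w (k + 1) 0 (by simp at hx; omega)
        subst h1
        have hu := Bool.count_eq_of_length_eq (by simp) x h3
        have hv : ((List.range' (k + 2 + u.length) v.length).map f).count x = v.count x := by
          have e : (u ++ (!x) :: v).length = u.length + (1 + v.length) := by simp; omega
          rw [e, ← List.range'_append_1, ← List.range'_append_1, List.range'_one] at hx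
          simp only [List.map_append, List.map_cons, List.map_nil, List.count_append,
            List.count_cons, List.count_nil, h2] at hx
          have e2 : k + 1 + u.length + 1 = k + 2 + u.length := by omega
          rw [e2] at hx
          simp at hx h3
          omega
        have hv' := Bool.count_eq_of_length_eq (by simp) x hv
        simp at hn
        obtain ⟨t₁, a1, a2⟩ := ih u.length (by omega) u rfl (k + 1) hu
        obtain ⟨t₂, b1, b2⟩ := ih v.length (by omega) v rfl (k + 2 + u.length) hv'
        refine ⟨.wrap t₁ t₂, by simp [Arrangement.size, a1, b1]; omega, ?_⟩
        simp [Arrangement.order, a1, a2, b2, h2, hf]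

/-! ### Tents -/

/-- A stop of a path at its base line. The path reaches the vertical through `arr`, lands at height
`land`, and starts again from the point `S`, which lies on a line of slope `1` or `-1` through the
point of the base line with abscissa `dep`. The point `c` is the centre of the column in which all
this happens. -/
structure Station where
  c : ℝ
  arr : ℝ
  dep : ℝ
  land : ℝ
  S : Plane

/-- The station at a vertex `(c, y)`; the signs `s` and `t` tell on which sides of the vertex the
path arrives and departs. -/
def vertexStation (c y s t : ℝ) : Station where
  c := c
  arr := c + 4 * s
  dep := c + t * (y + 2)
  land := -1
  S := (c, y)

/-- The station where a path passes below the vertex in column `c`. -/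
def dipStation (c : ℝ) : Station where
  c := c
  arr := c - 8
  dep := c + 8
  land := -2
  S := (c + 8, -2)

/-- The station used for the far end of a path. -/
def farStation (c : ℝ) : Station where
  c := c
  arr := c + 2
  dep := c + 6
  land := 0
  S := (c + 8, 0)

/-- A station is of one of the three kinds. -/
inductive Station.WF : Station → Prop
  | vertex (c y s t : ℝ) (hy : |y| ≤ 1 / 2) (hs : s = -1 ∨ s = 1) (ht : t = -1 ∨ t = 1) :
      WF (vertexStation c y s t)
  | dip (c : ℝ) : WF (dipStation c)
  | far (c : ℝ) : WF (farStation c)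

/-- Two stations lie in columns far apart, or they are a vertex and the dip below it. -/
def Station.Sep (e f : Station) : Prop :=
  100 ≤ |e.c - f.c| ∨ (e.c = f.c ∧ ((e.land = -1 ∧ f.land = -2) ∨ (e.land = -2 ∧ f.land = -1)))

theorem Station.Sep.symm {e f : Station} (h : e.Sep f) : f.Sep e := by
  rcases h with h | ⟨h, h'⟩
  · exact Or.inl (by rwa [abs_sub_comm])
  · exact Or.inr ⟨h.symm, by tauto⟩

/-- The path can go from `e` to `f` along a tent. -/
def Link (e f : Station) : Prop :=
  (e.dep + 20 ≤ f.arr ∧ e.S.1 = e.dep + (e.S.2 + 2)) ∨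
    (f.arr + 20 ≤ e.dep ∧ e.S.1 = e.dep - (e.S.2 + 2))

/-- The left end of the tent. -/
noncomputable def tentLo (p : Station × Station) : ℝ := min p.1.dep p.2.arr

/-- The right end of the tent. -/
noncomputable def tentHi (p : Station × Station) : ℝ := max p.1.dep p.2.arr

/-- Two tents are disjoint or nested. -/
def NonCrossing (p q : Station × Station) : Prop :=
  tentHi p < tentLo q ∨ tentHi q < tentLo p ∨ (tentLo p < tentLo q ∧ tentHi q < tentHi p) ∨
    (tentLo q < tentLo p ∧ tentHi p < tentHi q)

/-- The top of the tent from `e` to `f`. -/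
noncomputable def apex (e f : Station) : Plane :=
  ((e.dep + f.arr) / 2, |f.arr - e.dep| / 2 - 2)

/-- The landing point of the tent from `e` to `f`. -/
noncomputable def landing (e f : Station) : Plane :=
  (if e.dep ≤ f.arr then f.arr - (f.land + 2) else f.arr + (f.land + 2), f.land)

/-- The tent from `e` to `f`, from the starting point of `e` to the landing point. -/
noncomputable def tentSet (e f : Station) : Set Plane :=
  segment ℝ e.S (apex e f) ∪ segment ℝ (apex e f) (landing e f)

/-- The segment at `f` from the landing point to the starting point of `f`. -/
noncomputable def groundSet (e f : Station) : Set Plane := segment ℝ (landing e f) f.S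

/-! ### Segments and linear functionals -/

theorem le_of_mem_segment {p r q : Plane} (hq : q ∈ segment ℝ p r) (α β γ : ℝ)
    (hp : α * p.1 + β * p.2 ≤ γ) (hr : α * r.1 + β * r.2 ≤ γ) : α * q.1 + β * q.2 ≤ γ := by
  obtain ⟨s, t, hs, ht, hst, rfl⟩ := hq
  simp only [Prod.fst_add, Prod.snd_add, Prod.smul_fst, Prod.smul_snd, smul_eq_mul]
  have h1 := mul_le_mul_of_nonneg_left hp hs
  have h2 := mul_le_mul_of_nonneg_left hr ht
  have h3 : s * γ + t * γ = γ := by rw [← add_mul, hst, one_mul]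
  linarith

/-- A linear functional that is not constant on a segment attains its minimum only at one end.
Choosing the functional turns every "these pieces share only an end" claim into linear arithmetic.
-/
theorem eq_left_of_mem_segment {p r q : Plane} (hq : q ∈ segment ℝ p r) (α β : ℝ)
    (h : α * q.1 + β * q.2 ≤ α * p.1 + β * p.2) (hr : α * p.1 + β * p.2 < α * r.1 + β * r.2) :
    q = p := by
  obtain ⟨s, t, hs, ht, hst, rfl⟩ := hq
  simp only [Prod.fst_add, Prod.snd_add, Prod.smul_fst, Prod.smul_snd, smul_eq_mul] at h
  obtain rfl : s = 1 - t := by linarith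
  have h0 : t * ((α * r.1 + β * r.2) - (α * p.1 + β * p.2)) ≤ 0 := by linarith
  have : t ≤ 0 := by
    by_contra! ht'
    have := mul_pos ht' (sub_pos.2 hr)
    linarith
  obtain rfl : t = 0 := le_antisymm this ht
  simp

theorem eq_right_of_mem_segment {p r q : Plane} (hq : q ∈ segment ℝ p r) (α β : ℝ)
    (h : α * q.1 + β * q.2 ≤ α * r.1 + β * r.2) (hr : α * r.1 + β * r.2 < α * p.1 + β * p.2) :
    q = r :=
  eq_left_of_mem_segment (by rwa [segment_symm]) α β h hr

/-! ### Where tents and ground segments can meet -/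

theorem Station.WF.bounds {e : Station} (h : e.WF) :
    |e.arr - e.c| ≤ 8 ∧ |e.dep - e.c| ≤ 8 ∧ -2 ≤ e.S.2 ∧ e.S.2 ≤ 1 / 2 ∧ -2 ≤ e.land ∧
      e.land ≤ 0 := by
  cases h with
  | vertex c y s t hy hs ht =>
    obtain ⟨h1, h2⟩ := abs_le.1 hy
    rcases hs with rfl | rfl <;> rcases ht with rfl | rfl <;> simp only [vertexStation, abs_le] <;>
      refine ⟨⟨?_, ?_⟩, ⟨?_, ?_⟩, ?_, ?_, ?_, ?_⟩ <;> linarith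
  | dip c => simp only [dipStation, abs_le]; norm_num
  | far c => simp only [farStation, abs_le]; norm_num

/-- Each leg lies on the line of slope 1 or -1 through its foot and below the line of the other leg;
these linear conditions hold at both ends of the leg. The two outer cases are tents going right and
going left. -/
theorem mem_tentSet {e f : Station} (he : e.WF) (hf : f.WF) (h : Link e f) {q : Plane}
    (hq : q ∈ tentSet e f) :
    (e.dep + 20 ≤ f.arr ∧ e.S.1 = e.dep + (e.S.2 + 2) ∧
      ((e.S.2 ≤ q.2 ∧ q.2 + 2 = q.1 - e.dep ∧ q.2 + 2 ≤ f.arr - q.1) ∨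
        (f.land ≤ q.2 ∧ q.2 + 2 = f.arr - q.1 ∧ q.2 + 2 ≤ q.1 - e.dep))) ∨
    (f.arr + 20 ≤ e.dep ∧ e.S.1 = e.dep - (e.S.2 + 2) ∧
      ((e.S.2 ≤ q.2 ∧ q.2 + 2 = e.dep - q.1 ∧ q.2 + 2 ≤ q.1 - f.arr) ∨
        (f.land ≤ q.2 ∧ q.2 + 2 = q.1 - f.arr ∧ q.2 + 2 ≤ e.dep - q.1))) := by
  obtain ⟨-, -, b1, b2, -, -⟩ := he.bounds
  obtain ⟨-, -, -, -, b3, b4⟩ := hf.bounds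
  rcases h with ⟨h1, h2⟩ | ⟨h1, h2⟩
  · refine Or.inl ⟨h1, h2, ?_⟩
    have e1 : (apex e f).2 = (f.arr - e.dep) / 2 - 2 := by
      simp only [apex]; rw [abs_of_nonneg (by linarith)]
    have e2 : (apex e f).1 = (e.dep + f.arr) / 2 := rfl
    have e3 : (landing e f).1 = f.arr - (f.land + 2) := by
      simp only [landing]; rw [if_pos (by linarith)]
    have e4 : (landing e f).2 = f.land := rfl
    rcases hq with hq | hq
    · left
      have a1 := le_of_mem_segment hq 0 (-1) (-e.S.2) (by linarith) (by linarith)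
      have a2 := le_of_mem_segment hq 1 (-1) (e.dep + 2) (by linarith) (by linarith)
      have a3 := le_of_mem_segment hq (-1) 1 (-e.dep - 2) (by linarith) (by linarith)
      have a4 := le_of_mem_segment hq 1 1 (f.arr - 2) (by linarith) (by linarith)
      refine ⟨?_, ?_, ?_⟩ <;> linarith
    · right
      have a1 := le_of_mem_segment hq 0 (-1) (-f.land) (by linarith) (by linarith)
      have a2 := le_of_mem_segment hq 1 1 (f.arr - 2) (by linarith) (by linarith)
      have a3 := le_of_mem_segment hq (-1) (-1) (-f.arr + 2) (by linarith) (by linarith)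
      have a4 := le_of_mem_segment hq (-1) 1 (-e.dep - 2) (by linarith) (by linarith)
      refine ⟨?_, ?_, ?_⟩ <;> linarith
  · refine Or.inr ⟨h1, h2, ?_⟩
    have e1 : (apex e f).2 = (e.dep - f.arr) / 2 - 2 := by
      simp only [apex]; rw [abs_of_nonpos (by linarith)]; ring
    have e2 : (apex e f).1 = (e.dep + f.arr) / 2 := rfl
    have e3 : (landing e f).1 = f.arr + (f.land + 2) := by
      simp only [landing]; rw [if_neg (by linarith)]
    have e4 : (landing e f).2 = f.land := rfl
    rcases hq with hq | hq
    · left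
      have a1 := le_of_mem_segment hq 0 (-1) (-e.S.2) (by linarith) (by linarith)
      have a2 := le_of_mem_segment hq 1 1 (e.dep - 2) (by linarith) (by linarith)
      have a3 := le_of_mem_segment hq (-1) (-1) (-e.dep + 2) (by linarith) (by linarith)
      have a4 := le_of_mem_segment hq (-1) 1 (-f.arr - 2) (by linarith) (by linarith)
      refine ⟨?_, ?_, ?_⟩ <;> linarith
    · right
      have a1 := le_of_mem_segment hq 0 (-1) (-f.land) (by linarith) (by linarith)
      have a2 := le_of_mem_segment hq 1 (-1) (f.arr + 2) (by linarith) (by linarith)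
      have a3 := le_of_mem_segment hq (-1) 1 (-f.arr - 2) (by linarith) (by linarith)
      have a4 := le_of_mem_segment hq 1 1 (e.dep - 2) (by linarith) (by linarith)
      refine ⟨?_, ?_, ?_⟩ <;> linarith

/-- The points of a tent in terms of its two ends. -/
theorem mem_tentSet' {e f : Station} (he : e.WF) (hf : f.WF) (h : Link e f) {q : Plane}
    (hq : q ∈ tentSet e f) :
    -2 ≤ q.2 ∧
    ((q.2 + 2 = q.1 - tentLo (e, f) ∧ q.2 + 2 ≤ tentHi (e, f) - q.1) ∨
      (q.2 + 2 = tentHi (e, f) - q.1 ∧ q.2 + 2 ≤ q.1 - tentLo (e, f))) := by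
  obtain ⟨-, -, b1, b2, -, -⟩ := he.bounds
  obtain ⟨-, -, -, -, b3, b4⟩ := hf.bounds
  rcases mem_tentSet he hf h hq with ⟨h1, -, h3⟩ | ⟨h1, -, h3⟩
  · have e1 : tentLo (e, f) = e.dep := min_eq_left (by simp only; linarith)
    have e2 : tentHi (e, f) = f.arr := max_eq_right (by simp only; linarith)
    rw [e1, e2]
    rcases h3 with ⟨h3, h4, h5⟩ | ⟨h3, h4, h5⟩
    · exact ⟨by linarith, Or.inl ⟨h4, h5⟩⟩
    · exact ⟨by linarith, Or.inr ⟨h4, h5⟩⟩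
  · have e1 : tentLo (e, f) = f.arr := min_eq_right (by simp only; linarith)
    have e2 : tentHi (e, f) = e.dep := max_eq_left (by simp only; linarith)
    rw [e1, e2]
    rcases h3 with ⟨h3, h4, h5⟩ | ⟨h3, h4, h5⟩
    · exact ⟨by linarith, Or.inr ⟨h4, h5⟩⟩
    · exact ⟨by linarith, Or.inl ⟨h4, h5⟩⟩

theorem Station.WF.eq_of_S_le {e : Station} (h : e.WF) (hS : e.S.2 ≤ -2) :
    e = dipStation e.c := by
  cases h with
  | vertex c y s t hy hs ht =>
    obtain ⟨h1, h2⟩ := abs_le.1 hy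
    simp only [vertexStation] at hS; linarith
  | dip c => rfl
  | far c => simp only [farStation] at hS; linarith

theorem Station.WF.eq_of_land_le {e : Station} (h : e.WF) (hS : e.land ≤ -2) :
    e = dipStation e.c := by
  cases h with
  | vertex c y s t hy hs ht => simp only [vertexStation] at hS; linarith
  | dip c => rfl
  | far c => simp only [farStation] at hS; linarith

/-- A tent reaches the base line only at dips. -/
theorem tentSet_bottom {e f : Station} (he : e.WF) (hf : f.WF) (h : Link e f) {q : Plane}
    (hq : q ∈ tentSet e f) (h2 : q.2 = -2) :
    (e = dipStation e.c ∧ q.1 = e.dep) ∨ (f = dipStation f.c ∧ q.1 = f.arr) := by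
  rcases mem_tentSet he hf h hq with ⟨h1, -, ⟨h3, h4, -⟩ | ⟨h3, h4, -⟩⟩ |
    ⟨h1, -, ⟨h3, h4, -⟩ | ⟨h3, h4, -⟩⟩
  · exact Or.inl ⟨he.eq_of_S_le (by linarith), by linarith⟩
  · exact Or.inr ⟨hf.eq_of_land_le (by linarith), by linarith⟩
  · exact Or.inl ⟨he.eq_of_S_le (by linarith), by linarith⟩
  · exact Or.inr ⟨hf.eq_of_land_le (by linarith), by linarith⟩

/-- Over the interval from `lo` to `hi` the tent is part of the graph of `min (x - lo) (hi - x) -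
2`. For strictly nested intervals one graph is strictly above the other, and for disjoint ones there
is no common abscissa. -/
theorem tentSet_disjoint {e f e' f' : Station} (he : e.WF) (hf : f.WF) (h : Link e f)
    (he' : e'.WF) (hf' : f'.WF) (h' : Link e' f') (hn : NonCrossing (e, f) (e', f'))
    {q : Plane} (hq : q ∈ tentSet e f) (hq' : q ∈ tentSet e' f') : False := by
  obtain ⟨a0, a⟩ := mem_tentSet' he hf h hq
  obtain ⟨-, b⟩ := mem_tentSet' he' hf' h' hq'
  rcases hn with hn | hn | ⟨hn, hn'⟩ | ⟨hn, hn'⟩ <;> rcases a with ⟨a1, a2⟩ | ⟨a1, a2⟩ <;>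
    rcases b with ⟨b1, b2⟩ | ⟨b1, b2⟩ <;> linarith

theorem landing_fst {e f : Station} (h : Link e f) :
    (e.dep + 20 ≤ f.arr ∧ (landing e f).1 = f.arr - (f.land + 2)) ∨
      (f.arr + 20 ≤ e.dep ∧ (landing e f).1 = f.arr + (f.land + 2)) := by
  rcases h with ⟨h1, h2⟩ | ⟨h1, h2⟩
  · left; refine ⟨h1, ?_⟩; simp only [landing]; rw [if_pos (by linarith)]
  · right; refine ⟨h1, ?_⟩; simp only [landing]; rw [if_neg (by linarith)]

/-- The region of a ground segment, in each of the three kinds of stations. -/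
theorem mem_groundSet {e f : Station} (hf : f.WF) (h : Link e f) {q : Plane}
    (hq : q ∈ groundSet e f) :
    (f.land = -1 ∧ -1 ≤ q.2 ∧ q.2 ≤ 1 / 2 ∧ f.c - 5 ≤ q.1 ∧ q.1 ≤ f.c + 5 ∧
      q.1 + q.2 ≤ f.c + 4 ∧ q.2 - q.1 ≤ 4 - f.c) ∨
    (f.land = -2 ∧ q.2 = -2 ∧ f.c - 8 ≤ q.1 ∧ q.1 ≤ f.c + 8) ∨
    (f.land = 0 ∧ q.2 = 0 ∧ f.c ≤ q.1 ∧ q.1 ≤ f.c + 8) := by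
  have e2 : (landing e f).2 = f.land := rfl
  have e1 : (landing e f).1 = f.arr - (f.land + 2) ∨ (landing e f).1 = f.arr + (f.land + 2) := by
    rcases landing_fst h with ⟨-, h⟩ | ⟨-, h⟩
    · exact Or.inl h
    · exact Or.inr h
  unfold groundSet at hq
  generalize landing e f = L at hq e1 e2
  cases hf with
  | vertex c y s t hy hs ht =>
    obtain ⟨h1, h2⟩ := abs_le.1 hy
    left
    simp only [vertexStation] at hq e1 e2 ⊢
    have b1 : L.1 ≤ c + 5 := by rcases hs with rfl | rfl <;> rcases e1 with e1 | e1 <;> linarith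
    have b2 : c - 5 ≤ L.1 := by rcases hs with rfl | rfl <;> rcases e1 with e1 | e1 <;> linarith
    have a1 := le_of_mem_segment hq 0 (-1) 1 (by linarith) (by simp only; linarith)
    have a2 := le_of_mem_segment hq 0 1 (1 / 2) (by linarith) (by simp only; linarith)
    have a3 := le_of_mem_segment hq 1 0 (c + 5) (by linarith) (by simp only; linarith)
    have a4 := le_of_mem_segment hq (-1) 0 (-(c - 5)) (by linarith) (by simp only; linarith)
    have a5 := le_of_mem_segment hq 1 1 (c + 4) (by linarith) (by simp only; linarith)
    have a6 := le_of_mem_segment hq (-1) 1 (4 - c) (by linarith) (by simp only; linarith)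
    refine ⟨trivial, ?_, ?_, ?_, ?_, ?_, ?_⟩ <;> linarith
  | dip c =>
    right; left
    simp only [dipStation] at hq e1 e2 ⊢
    have b1 : L.1 = c - 8 := by rcases e1 with e1 | e1 <;> linarith
    have a1 := le_of_mem_segment hq 0 (-1) 2 (by linarith) (by simp only; linarith)
    have a2 := le_of_mem_segment hq 0 1 (-2) (by linarith) (by simp only; linarith)
    have a3 := le_of_mem_segment hq 1 0 (c + 8) (by linarith) (by simp only; linarith)
    have a4 := le_of_mem_segment hq (-1) 0 (-(c - 8)) (by linarith) (by simp only; linarith)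
    refine ⟨trivial, ?_, ?_, ?_⟩ <;> linarith
  | far c =>
    right; right
    simp only [farStation] at hq e1 e2 ⊢
    have b1 : L.1 ≤ c + 8 := by rcases e1 with e1 | e1 <;> linarith
    have b2 : c ≤ L.1 := by rcases e1 with e1 | e1 <;> linarith
    have a1 := le_of_mem_segment hq 0 (-1) 0 (by linarith) (by simp only; linarith)
    have a2 := le_of_mem_segment hq 0 1 0 (by linarith) (by simp only; linarith)
    have a3 := le_of_mem_segment hq 1 0 (c + 8) (by linarith) (by simp only; linarith)
    have a4 := le_of_mem_segment hq (-1) 0 (-c) (by linarith) (by simp only; linarith)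
    refine ⟨trivial, ?_, ?_, ?_⟩ <;> linarith

theorem groundSet_disjoint {e f e' f' : Station} (hf : f.WF) (h : Link e f) (hf' : f'.WF)
    (h' : Link e' f') (hs : f.Sep f') {q : Plane} (hq : q ∈ groundSet e f)
    (hq' : q ∈ groundSet e' f') : False := by
  have a := mem_groundSet hf h hq
  have b := mem_groundSet hf' h' hq'
  rcases hs with hs | ⟨hs, hs'⟩
  · rcases le_abs.1 hs with hs | hs <;>
    rcases a with ⟨-, -, -, a1, a2, -⟩ | ⟨-, -, a1, a2⟩ | ⟨-, -, a1, a2⟩ <;>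
    rcases b with ⟨-, -, -, b1, b2, -⟩ | ⟨-, -, b1, b2⟩ | ⟨-, -, b1, b2⟩ <;> linarith
  · rcases hs' with ⟨c1, c2⟩ | ⟨c1, c2⟩ <;>
    rcases a with ⟨d1, a1, a2, -⟩ | ⟨d1, a1, -, -⟩ | ⟨d1, a1, -, -⟩ <;>
    rcases b with ⟨d2, b1, b2, -⟩ | ⟨d2, b1, -, -⟩ | ⟨d2, b1, -, -⟩ <;> linarith

/-- The ends of a station keep away from the middle of every column except that of a vertex
station at the same place. -/
theorem Station.WF.ends_far {e v : Station} (he : e.WF) (hs : e.Sep v) (hv : v.land ≠ -2) :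
    7 ≤ |e.arr - v.c| ∧ 7 ≤ |e.dep - v.c| ∧
      (v.land ≠ -1 → 90 ≤ |e.arr - v.c| ∧ 90 ≤ |e.dep - v.c|) := by
  obtain ⟨b1, b2, -⟩ := he.bounds
  rcases hs with hs | ⟨hs, hs'⟩
  · have h1 : |e.c - v.c| ≤ |e.arr - v.c| + |e.arr - e.c| := by
      have := abs_sub_le e.c e.arr v.c
      rw [abs_sub_comm e.c e.arr] at this; linarith
    have h2 : |e.c - v.c| ≤ |e.dep - v.c| + |e.dep - e.c| := by
      have := abs_sub_le e.c e.dep v.c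
      rw [abs_sub_comm e.c e.dep] at this; linarith
    exact ⟨by linarith, by linarith, fun _ => ⟨by linarith, by linarith⟩⟩
  · rcases hs' with ⟨-, h⟩ | ⟨h, h'⟩
    · exact absurd h hv
    · have := he.eq_of_land_le h.le
      rw [this, ← hs]
      refine ⟨?_, ?_, fun h => absurd h' h⟩
      · simp only [dipStation, le_abs]; right; linarith
      · simp only [dipStation, le_abs]; left; linarith

theorem Station.Sep.dip_false {d : ℝ} {v : Station} (h : (dipStation d).Sep v) (hv : v.land = -2)
    {x : ℝ} (h1 : d - 8 ≤ x) (h2 : x ≤ d + 8) (h3 : v.c - 8 ≤ x) (h4 : x ≤ v.c + 8) : False := by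
  rcases h with h | ⟨-, ⟨h, -⟩ | ⟨-, h⟩⟩
  · simp only [dipStation] at h
    rcases le_abs.1 h with h | h <;> linarith
  · simp only [dipStation] at h; norm_num at h
  · rw [hv] at h; norm_num at h

theorem tentSet_groundSet_disjoint {e f u v : Station} (he : e.WF) (hf : f.WF) (h : Link e f)
    (hv : v.WF) (h' : Link u v) (h1 : e.Sep v) (h2 : f.Sep v) {q : Plane}
    (hq : q ∈ tentSet e f) (hq' : q ∈ groundSet u v) : False := by
  rcases mem_groundSet hv h' hq' with ⟨l, g1, g2, g3, g4, g5, g6⟩ | ⟨l, g1, g2, g3⟩ |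
    ⟨l, g1, g2, g3⟩
  · have f1 := (hf.ends_far h2 (by rw [l]; norm_num)).1
    have f2 := (he.ends_far h1 (by rw [l]; norm_num)).2.1
    rcases le_abs.1 f1 with f1 | f1 <;> rcases le_abs.1 f2 with f2 | f2 <;>
      rcases mem_tentSet he hf h hq with ⟨a1, -, ⟨-, a2, a3⟩ | ⟨-, a2, a3⟩⟩ |
        ⟨a1, -, ⟨-, a2, a3⟩ | ⟨-, a2, a3⟩⟩ <;> linarith
  · rcases tentSet_bottom he hf h hq g1 with ⟨b1, b2⟩ | ⟨b1, b2⟩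
    · rw [b1] at b2 h1
      exact h1.dip_false l (by rw [b2]; simp only [dipStation]; linarith)
        (by rw [b2]; simp only [dipStation]; linarith) g2 g3
    · rw [b1] at b2 h2
      exact h2.dip_false l (by rw [b2]; simp only [dipStation]; linarith)
        (by rw [b2]; simp only [dipStation]; linarith) g2 g3
  · have f1 := ((hf.ends_far h2 (by rw [l]; norm_num)).2.2 (by rw [l]; norm_num)).1
    have f2 := ((he.ends_far h1 (by rw [l]; norm_num)).2.2 (by rw [l]; norm_num)).2
    rcases le_abs.1 f1 with f1 | f1 <;> rcases le_abs.1 f2 with f2 | f2 <;>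
      rcases mem_tentSet he hf h hq with ⟨a1, -, ⟨-, a2, a3⟩ | ⟨-, a2, a3⟩⟩ |
        ⟨a1, -, ⟨-, a2, a3⟩ | ⟨-, a2, a3⟩⟩ <;> linarith

/-- At a vertex, a functional separates the arriving leg from the ground segment: the abscissa when
the path keeps its direction after landing, and the functional constant on the leg when it turns
back. -/
theorem tentSet_own_arrival {u v : Station} (hu : u.WF) (hv : v.WF) (h : Link u v) (hs : u.Sep v)
    {q : Plane} (hq : q ∈ tentSet u v) (hq' : q ∈ groundSet u v) : q = landing u v := by
  have hg := mem_groundSet hv h hq'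
  have hb := tentSet_bottom hu hv h hq
  have ht := mem_tentSet hu hv h hq
  have e1 := landing_fst h
  have e2 : (landing u v).2 = v.land := rfl
  unfold groundSet at hq'
  generalize landing u v = L at hq' e1 e2 ⊢
  clear h hq
  cases hv with
  | vertex c y s t hy hs' ht' =>
    obtain ⟨h1, h2⟩ := abs_le.1 hy
    rcases hg with ⟨l, g1, g2, g3, g4, g5, g6⟩ | ⟨l, -⟩ | ⟨l, -⟩
    · simp only [vertexStation] at *
      rcases hs' with rfl | rfl
      · rcases e1 with ⟨e0, e1⟩ | ⟨e0, e1⟩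
        · refine eq_left_of_mem_segment hq' 1 0 ?_ (by simp only; linarith)
          rcases ht with ⟨a1, -, ⟨a0, a2, a3⟩ | ⟨a0, a2, a3⟩⟩ |
            ⟨a1, -, ⟨-, a2, a3⟩ | ⟨-, a2, a3⟩⟩ <;> linarith
        · refine eq_left_of_mem_segment hq' 1 (-1) ?_ (by simp only; linarith)
          rcases ht with ⟨a1, -, ⟨a0, a2, a3⟩ | ⟨a0, a2, a3⟩⟩ |
            ⟨a1, -, ⟨-, a2, a3⟩ | ⟨-, a2, a3⟩⟩ <;> linarith
      · rcases e1 with ⟨e0, e1⟩ | ⟨e0, e1⟩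
        · refine eq_left_of_mem_segment hq' (-1) (-1) ?_ (by simp only; linarith)
          rcases ht with ⟨a1, -, ⟨a0, a2, a3⟩ | ⟨a0, a2, a3⟩⟩ |
            ⟨a1, -, ⟨-, a2, a3⟩ | ⟨-, a2, a3⟩⟩ <;> linarith
        · refine eq_left_of_mem_segment hq' (-1) 0 ?_ (by simp only; linarith)
          rcases ht with ⟨a1, -, ⟨a0, a2, a3⟩ | ⟨a0, a2, a3⟩⟩ |
            ⟨a1, -, ⟨-, a2, a3⟩ | ⟨-, a2, a3⟩⟩ <;> linarith
    · simp only [vertexStation] at l; norm_num at l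
    · simp only [vertexStation] at l; norm_num at l
  | dip c =>
    rcases hg with ⟨l, -⟩ | ⟨l, g1, g2, g3⟩ | ⟨l, -⟩
    · simp only [dipStation] at l; norm_num at l
    · rcases hb g1 with ⟨b1, b2⟩ | ⟨-, b2⟩
      · rw [b1] at b2 hs
        exact (hs.dip_false l (by rw [b2]; simp only [dipStation]; linarith)
          (by rw [b2]; simp only [dipStation]; linarith) g2 g3).elim
      · simp only [dipStation] at *
        refine Prod.ext ?_ (by linarith)
        rcases e1 with ⟨-, e1⟩ | ⟨-, e1⟩ <;> linarith
    · simp only [dipStation] at l; norm_num at l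
  | far c =>
    rcases hg with ⟨l, -⟩ | ⟨l, -⟩ | ⟨l, g1, g2, g3⟩
    · simp only [farStation] at l; norm_num at l
    · simp only [farStation] at l; norm_num at l
    · simp only [farStation] at *
      refine Prod.ext ?_ (by linarith)
      rcases e1 with ⟨e0, e1⟩ | ⟨e0, e1⟩ <;>
        rcases ht with ⟨a1, -, ⟨a0, a2, a3⟩ | ⟨a0, a2, a3⟩⟩ |
            ⟨a1, -, ⟨a0, a2, a3⟩ | ⟨a0, a2, a3⟩⟩ <;> linarith

/-- At a vertex, height separates: the ground segment rises to `v.S` and the departing leg starts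
there and goes up. -/
theorem tentSet_own_departure {u v w : Station} (hv : v.WF) (hw : w.WF) (h : Link u v)
    (h' : Link v w) (hs : v.Sep w) {q : Plane} (hq : q ∈ tentSet v w) (hq' : q ∈ groundSet u v) :
    q = v.S := by
  have hg := mem_groundSet hv h hq'
  have hb := tentSet_bottom hv hw h' hq
  have ht := mem_tentSet hv hw h' hq
  have e2 : (landing u v).2 = v.land := rfl
  unfold groundSet at hq'
  generalize landing u v = L at hq' e2
  clear h h' hq
  cases hv with
  | vertex c y s t hy hs' ht' =>
    obtain ⟨h1, h2⟩ := abs_le.1 hy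
    rcases hg with ⟨l, g1, g2, g3, g4, g5, g6⟩ | ⟨l, -⟩ | ⟨l, -⟩
    · simp only [vertexStation] at *
      refine eq_right_of_mem_segment hq' 0 (-1) ?_ (by simp only; linarith)
      rcases ht with ⟨a1, a4, ⟨a0, a2, a3⟩ | ⟨a0, a2, a3⟩⟩ |
        ⟨a1, a4, ⟨a0, a2, a3⟩ | ⟨a0, a2, a3⟩⟩ <;> simp only <;> linarith
    · simp only [vertexStation] at l; norm_num at l
    · simp only [vertexStation] at l; norm_num at l
  | dip c =>
    rcases hg with ⟨l, -⟩ | ⟨l, g1, g2, g3⟩ | ⟨l, -⟩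
    · simp only [dipStation] at l; norm_num at l
    · rcases hb g1 with ⟨-, b2⟩ | ⟨b1, b2⟩
      · simp only [dipStation] at *
        exact Prod.ext b2 g1
      · rw [b1] at b2 hs
        exact (hs.symm.dip_false l (by rw [b2]; simp only [dipStation]; linarith)
          (by rw [b2]; simp only [dipStation]; linarith) g2 g3).elim
    · simp only [dipStation] at l; norm_num at l
  | far c =>
    rcases hg with ⟨l, -⟩ | ⟨l, -⟩ | ⟨l, g1, g2, g3⟩
    · simp only [farStation] at l; norm_num at l
    · simp only [farStation] at l; norm_num at l
    · simp only [farStation] at *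
      refine Prod.ext ?_ g1
      rcases ht with ⟨a1, a4, ⟨a0, a2, a3⟩ | ⟨a0, a2, a3⟩⟩ |
        ⟨a1, a4, ⟨a0, a2, a3⟩ | ⟨a0, a2, a3⟩⟩ <;> simp only <;> linarith

theorem start_ne_apex {e f : Station} (he : e.WF) (h : Link e f) : e.S ≠ apex e f := by
  intro hS
  have h1 := he.bounds.2.2.2.1
  have h2 : (apex e f).2 = |f.arr - e.dep| / 2 - 2 := rfl
  rw [← hS] at h2
  have : 20 ≤ |f.arr - e.dep| := by
    rw [le_abs]
    rcases h with ⟨h, -⟩ | ⟨h, -⟩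
    · left; linarith
    · right; linarith
  linarith

theorem apex_ne_landing {e f : Station} (hf : f.WF) (h : Link e f) : apex e f ≠ landing e f := by
  intro hS
  have h1 := hf.bounds.2.2.2.2.2
  have h2 : (apex e f).2 = |f.arr - e.dep| / 2 - 2 := rfl
  have h3 : (landing e f).2 = f.land := rfl
  rw [← hS] at h3
  have : 20 ≤ |f.arr - e.dep| := by
    rw [le_abs]
    rcases h with ⟨h, -⟩ | ⟨h, -⟩
    · left; linarith
    · right; linarith
  linarith

theorem landing_ne_start {e f : Station} (hf : f.WF) (h : Link e f) : landing e f ≠ f.S := by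
  intro hS
  have e1 := landing_fst h
  have e2 : (landing e f).2 = f.land := rfl
  rw [hS] at e1 e2
  cases hf with
  | vertex c y s t hy hs ht =>
    obtain ⟨h1, h2⟩ := abs_le.1 hy
    simp only [vertexStation] at e2; linarith
  | dip c => simp only [dipStation] at e1; rcases e1 with ⟨-, e1⟩ | ⟨-, e1⟩ <;> linarith
  | far c => simp only [farStation] at e1; rcases e1 with ⟨-, e1⟩ | ⟨-, e1⟩ <;> linarith

theorem eq_apex_of_mem {e f : Station} (he : e.WF) (hf : f.WF) (h : Link e f) {q : Plane}
    (hq : q ∈ segment ℝ e.S (apex e f)) (hq' : q ∈ segment ℝ (apex e f) (landing e f)) :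
    q = apex e f := by
  have b2 := he.bounds.2.2.2.1
  have b4 := hf.bounds.2.2.2.2.2
  have e2 : (apex e f).1 = (e.dep + f.arr) / 2 := rfl
  have e4 : (landing e f).2 = f.land := rfl
  have e3 := landing_fst h
  rcases h with ⟨h1, h2⟩ | ⟨h1, h2⟩
  · have e1 : (apex e f).2 = (f.arr - e.dep) / 2 - 2 := by
      simp only [apex]; rw [abs_of_nonneg (by linarith)]
    rcases e3 with ⟨e0, e3⟩ | ⟨e0, e3⟩
    · have a2 := le_of_mem_segment hq' (-1) 0 (-(e.dep + f.arr) / 2) (by linarith) (by linarith)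
      exact eq_right_of_mem_segment hq (-1) 0 (by linarith) (by linarith)
    · linarith
  · have e1 : (apex e f).2 = (e.dep - f.arr) / 2 - 2 := by
      simp only [apex]; rw [abs_of_nonpos (by linarith)]; ring
    rcases e3 with ⟨e0, e3⟩ | ⟨e0, e3⟩
    · linarith
    · have a2 := le_of_mem_segment hq' 1 0 ((e.dep + f.arr) / 2) (by linarith) (by linarith)
      exact eq_right_of_mem_segment hq 1 0 (by linarith) (by linarith)

/-! ### Chains of stations -/

/-- The pairs of consecutive members of a list. -/
def consec {α : Type*} : List α → List (α × α)
  | [] => []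
  | [_] => []
  | a :: b :: l => (a, b) :: consec (b :: l)

theorem consec_append {α : Type*} (A : List α) (x y : α) (B : List α) :
    consec (A ++ [x] ++ y :: B) = consec (A ++ [x]) ++ (x, y) :: consec (y :: B) := by
  induction A with
  | nil => rfl
  | cons a A ih =>
    cases A with
    | nil => rfl
    | cons b A => simpa [consec] using ih

theorem mem_of_mem_consec {α : Type*} {x : α} {l : List α} {p : α × α}
    (hp : p ∈ consec (x :: l)) : p.1 ∈ x :: l ∧ p.2 ∈ l := by
  induction l generalizing x with
  | nil => simp [consec] at hp
  | cons y l ih =>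
    simp only [consec, List.mem_cons] at hp
    rcases hp with rfl | hp
    · simp
    · have := ih hp
      exact ⟨List.mem_cons_of_mem _ this.1, List.mem_cons_of_mem _ this.2⟩

/-- Stations that a path may visit in the given order. -/
structure Drawable (G : List Station) : Prop where
  wf : ∀ e ∈ G, e.WF
  sep : G.Pairwise Station.Sep
  link : ∀ p ∈ consec G, Link p.1 p.2
  nc : (consec G).Pairwise NonCrossing

theorem Drawable.tail {e : Station} {G : List Station} (h : Drawable (e :: G)) : Drawable G := by
  cases G with
  | nil => exact ⟨by simp, List.Pairwise.nil, by simp [consec], by simp [consec]⟩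
  | cons f G =>
    exact ⟨fun x hx => h.wf x (List.mem_cons_of_mem _ hx), (List.pairwise_cons.1 h.sep).2,
      fun p hp => h.link p (List.mem_cons_of_mem _ hp), (List.pairwise_cons.1 h.nc).2⟩

/-- The corners of the path through a list of stations. -/
noncomputable def stationCorners : List Station → List Plane
  | [] => []
  | [e] => [e.S]
  | e :: f :: G => e.S :: apex e f :: landing e f :: stationCorners (f :: G)

theorem stationCorners_cons (f : Station) (G : List Station) :
    ∃ l, stationCorners (f :: G) = f.S :: l := by
  cases G with
  | nil => exact ⟨[], rfl⟩
  | cons g G => exact ⟨_, rfl⟩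

theorem mem_stationCorners {e : Station} {G : List Station} {q : Plane}
    (hq : q ∈ polylineSet (stationCorners (e :: G))) :
    (∃ p ∈ consec (e :: G), q ∈ tentSet p.1 p.2 ∨ q ∈ groundSet p.1 p.2) ∨ (G = [] ∧ q = e.S) := by
  induction G generalizing e with
  | nil => right; exact ⟨rfl, hq⟩
  | cons f G ih =>
    left
    obtain ⟨l, hl⟩ := stationCorners_cons f G
    rw [stationCorners, hl, polylineSet_cons_cons, polylineSet_cons_cons, polylineSet_cons_cons,
      ← hl] at hq
    rcases hq with hq | hq | hq | hq
    · exact ⟨(e, f), by simp [consec], Or.inl (Or.inl hq)⟩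
    · exact ⟨(e, f), by simp [consec], Or.inl (Or.inr hq)⟩
    · exact ⟨(e, f), by simp [consec], Or.inr hq⟩
    · rcases ih hq with ⟨p, hp, hp'⟩ | ⟨rfl, rfl⟩
      · exact ⟨p, List.mem_cons_of_mem _ hp, hp'⟩
      · exact ⟨(e, f), by simp [consec], Or.inr (right_mem_segment ℝ _ _)⟩

/-- Induction from the far end: three segments are put in front of a simple polyline. The tent
misses the remaining chain altogether (`H2`), and the ground segment meets it only in the next
starting point (`H3`). -/
theorem Drawable.simple {G : List Station} (h : Drawable G) :
    IsSimplePolyline (stationCorners G) := by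
  induction G with
  | nil => trivial
  | cons e G ih =>
    cases G with
    | nil => trivial
    | cons f G =>
      have hT := ih h.tail
      have he : e.WF := h.wf e (by simp)
      have hf : f.WF := h.wf f (by simp)
      have hl : Link e f := h.link (e, f) (by simp [consec])
      obtain ⟨s1, s2⟩ := List.pairwise_cons.1 h.sep
      obtain ⟨s3, -⟩ := List.pairwise_cons.1 s2
      have hn := (List.pairwise_cons.1 h.nc).1
      have hef : e.Sep f := s1 f (by simp)
      have hwf : ∀ p ∈ consec (f :: G), p.1.WF ∧ p.2.WF := fun p hp =>
        have hm := mem_of_mem_consec hp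
        ⟨h.wf _ (List.mem_cons_of_mem _ hm.1),
          h.wf _ (List.mem_cons_of_mem _ (List.mem_cons_of_mem _ hm.2))⟩
      have hlink : ∀ p ∈ consec (f :: G), Link p.1 p.2 := fun p hp =>
        h.link p (List.mem_cons_of_mem _ hp)
      have H2 : ∀ q ∈ tentSet e f, q ∉ polylineSet (stationCorners (f :: G)) := by
        intro q hq hq'
        rcases mem_stationCorners hq' with ⟨p, hp, hp' | hp'⟩ | ⟨-, rfl⟩
        · exact tentSet_disjoint he hf hl (hwf p hp).1 (hwf p hp).2 (hlink p hp) (hn p hp) hq hp'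
        · have hm := (mem_of_mem_consec hp).2
          exact tentSet_groundSet_disjoint he hf hl (hwf p hp).2 (hlink p hp)
            (s1 _ (List.mem_cons_of_mem _ hm)) (s3 _ hm) hq hp'
        · exact landing_ne_start hf hl
            (tentSet_own_arrival he hf hl hef hq (right_mem_segment ℝ _ _)).symm
      have H3 : ∀ q ∈ groundSet e f, q ∈ polylineSet (stationCorners (f :: G)) → q = f.S := by
        intro q hq hq'
        rcases mem_stationCorners hq' with ⟨p, hp, hp' | hp'⟩ | ⟨-, rfl⟩
        · cases G with
          | nil => simp [consec] at hp
          | cons g G =>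
            simp only [consec, List.mem_cons] at hp
            rcases hp with rfl | hp
            · exact tentSet_own_departure hf (h.wf g (by simp)) hl
                (hlink (f, g) (by simp [consec])) (s3 g (by simp)) hp' hq
            · have hm := mem_of_mem_consec hp
              have hp1 : p ∈ consec (f :: g :: G) := List.mem_cons_of_mem _ hp
              exact (tentSet_groundSet_disjoint (hwf p hp1).1 (hwf p hp1).2 (hlink p hp1) hf hl
                (s3 _ hm.1).symm (s3 _ (List.mem_cons_of_mem _ hm.2)).symm hp' hq).elim
        · exact (groundSet_disjoint hf hl (hwf p hp).2 (hlink p hp)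
            (s3 _ (mem_of_mem_consec hp).2) hq hp').elim
        · rfl
      obtain ⟨l, hC⟩ := stationCorners_cons f G
      have hS : f.S ∈ polylineSet (stationCorners (f :: G)) := by
        rw [hC]; exact head_mem_polylineSet _ _
      rw [stationCorners, hC, isSimplePolyline_cons_cons, isSimplePolyline_cons_cons,
        isSimplePolyline_cons_cons, polylineSet_cons_cons, polylineSet_cons_cons, ← hC]
      refine ⟨start_ne_apex he hl, ?_, apex_ne_landing hf hl, ?_, landing_ne_start hf hl, ?_, hT⟩
      · ext q
        constructor
        · rintro ⟨hq, hq' | hq' | hq'⟩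
          · exact eq_apex_of_mem he hf hl hq hq'
          · have := tentSet_own_arrival he hf hl hef (Or.inl hq) hq'
            refine eq_apex_of_mem he hf hl hq ?_
            rw [this]; exact right_mem_segment ℝ _ _
          · exact (H2 q (Or.inl hq) hq').elim
        · rintro rfl
          exact ⟨right_mem_segment ℝ _ _, Or.inl (left_mem_segment ℝ _ _)⟩
      · ext q
        constructor
        · rintro ⟨hq, hq' | hq'⟩
          · exact tentSet_own_arrival he hf hl hef (Or.inr hq) hq'
          · exact (H2 q (Or.inr hq) hq').elim
        · rintro rfl
          exact ⟨right_mem_segment ℝ _ _, Or.inl (left_mem_segment ℝ _ _)⟩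
      · ext q
        constructor
        · rintro ⟨hq, hq'⟩
          exact H3 q hq hq'
        · rintro rfl
          exact ⟨right_mem_segment ℝ _ _, hS⟩

/-! ### Building the chains of stations -/

/-- A drawable chain of stations between the verticals `a` and `b` that starts at `f` and ends at
`l`, such that the first arrival and the last departure are below no tent of the chain, and a tent
departing to the right is possible at the end. -/
structure Block (G : List Station) (f l : Station) (a b : ℝ) : Prop where
  head : ∃ B, G = f :: B
  last : ∃ A, G = A ++ [l]
  draw : Drawable G
  box : ∀ e ∈ G, (a ≤ e.arr ∧ e.arr ≤ b) ∧ (a ≤ e.dep ∧ e.dep ≤ b) ∧ a + 8 ≤ e.c ∧ e.c + 8 ≤ b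
  first : f.arr < l.dep ∧ ∀ p ∈ consec G, f.arr < tentLo p
  out : l.S.1 = l.dep + (l.S.2 + 2) ∧ ∀ p ∈ consec G, l.dep < tentLo p ∨ tentHi p < l.dep

theorem tentLo_right {p : Station × Station} (h : p.1.dep ≤ p.2.arr) : tentLo p = p.1.dep :=
  min_eq_left h
theorem tentLo_left {p : Station × Station} (h : p.2.arr ≤ p.1.dep) : tentLo p = p.2.arr :=
  min_eq_right h
theorem tentHi_right {p : Station × Station} (h : p.1.dep ≤ p.2.arr) : tentHi p = p.2.arr :=
  max_eq_right h
theorem tentHi_left {p : Station × Station} (h : p.2.arr ≤ p.1.dep) : tentHi p = p.1.dep :=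
  max_eq_left h

theorem Block.mem_first {G : List Station} {f l : Station} {a b : ℝ} (h : Block G f l a b) :
    f ∈ G := by
  obtain ⟨B, rfl⟩ := h.head; simp

theorem Block.mem_last {G : List Station} {f l : Station} {a b : ℝ} (h : Block G f l a b) :
    l ∈ G := by
  obtain ⟨B, rfl⟩ := h.last; simp

theorem Block.mem_consec {G : List Station} {f l : Station} {a b : ℝ} (h : Block G f l a b)
    {p : Station × Station} (hp : p ∈ consec G) : p.1 ∈ G ∧ p.2 ∈ G := by
  obtain ⟨B, rfl⟩ := h.head
  exact ⟨(mem_of_mem_consec hp).1, List.mem_cons_of_mem _ (mem_of_mem_consec hp).2⟩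

theorem Block.tent_box {G : List Station} {f l : Station} {a b : ℝ} (h : Block G f l a b)
    {p : Station × Station} (hp : p ∈ consec G) : a ≤ tentLo p ∧ tentHi p ≤ b := by
  obtain ⟨h1, h2⟩ := h.mem_consec hp
  have b1 := (h.box _ h1).2.1
  have b2 := (h.box _ h2).1
  exact ⟨le_min b1.1 b2.1, max_le b1.2 b2.2⟩

theorem Block.consec_append {G₁ G₂ : List Station} {f₁ l₁ f₂ l₂ : Station} {a₁ b₁ a₂ b₂ : ℝ}
    (h₁ : Block G₁ f₁ l₁ a₁ b₁) (h₂ : Block G₂ f₂ l₂ a₂ b₂) :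
    consec (G₁ ++ G₂) = consec G₁ ++ (l₁, f₂) :: consec G₂ := by
  obtain ⟨A, rfl⟩ := h₁.last
  obtain ⟨B, rfl⟩ := h₂.head
  exact _root_.consec_append A l₁ f₂ B

theorem Station.sep_of_lt {e f : Station} (h : e.c + 100 ≤ f.c) : e.Sep f :=
  Or.inl (le_abs.2 (Or.inr (by linarith)))

theorem Station.sep_of_gt {e f : Station} (h : f.c + 100 ≤ e.c) : e.Sep f :=
  Or.inl (le_abs.2 (Or.inl (by linarith)))

/-- One new tent joins `l₁` to `f₂`. By `out`, every tent of the first block ends left of it or is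
nested inside it; by `first`, all tents of the second block lie to its right. The gap 84 and the two
margins of 8 keep the centres 100 apart. -/
theorem Block.append {G₁ G₂ : List Station} {f₁ l₁ f₂ l₂ : Station} {a₁ b₁ a₂ b₂ : ℝ}
    (h₁ : Block G₁ f₁ l₁ a₁ b₁) (h₂ : Block G₂ f₂ l₂ a₂ b₂) (hab : b₁ + 84 ≤ a₂) :
    Block (G₁ ++ G₂) f₁ l₂ a₁ b₂ := by
  have hc := h₁.consec_append h₂
  have k1 := h₁.box _ h₁.mem_last
  have k2 := h₂.box _ h₂.mem_first
  have k3 := h₁.box _ h₁.mem_first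
  have k4 := h₂.box _ h₂.mem_last
  have elo : tentLo (l₁, f₂) = l₁.dep := tentLo_right (by simp only; linarith)
  have ehi : tentHi (l₁, f₂) = f₂.arr := tentHi_right (by simp only; linarith)
  refine ⟨?_, ?_, ⟨?_, ?_, ?_, ?_⟩, ?_, ⟨?_, ?_⟩, ⟨h₂.out.1, ?_⟩⟩
  · obtain ⟨B, rfl⟩ := h₁.head; exact ⟨_, rfl⟩
  · obtain ⟨A, rfl⟩ := h₂.last; exact ⟨G₁ ++ A, by simp⟩
  · intro e he
    rcases List.mem_append.1 he with he | he
    · exact h₁.draw.wf e he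
    · exact h₂.draw.wf e he
  · refine List.pairwise_append.2 ⟨h₁.draw.sep, h₂.draw.sep, fun e he f hf => ?_⟩
    have := h₁.box e he
    have := h₂.box f hf
    exact Station.sep_of_lt (by linarith)
  · intro p hp
    rw [hc, List.mem_append, List.mem_cons] at hp
    rcases hp with hp | rfl | hp
    · exact h₁.draw.link p hp
    · exact Or.inl ⟨by simp only; linarith, h₁.out.1⟩
    · exact h₂.draw.link p hp
  · rw [hc, List.pairwise_append, List.pairwise_cons]
    refine ⟨h₁.draw.nc, ⟨fun q hq => ?_, h₂.draw.nc⟩, fun p hp q hq => ?_⟩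
    · left; rw [ehi]; exact h₂.first.2 q hq
    · rw [List.mem_cons] at hq
      have hp' := h₁.tent_box hp
      rcases hq with rfl | hq
      · rcases h₁.out.2 p hp with h | h
        · right; right; right; rw [elo, ehi]; exact ⟨h, by linarith⟩
        · left; rw [elo]; exact h
      · left
        have := h₂.tent_box hq
        linarith
  · intro e he
    rcases List.mem_append.1 he with he | he
    · have := h₁.box e he
      refine ⟨⟨?_, ?_⟩, ⟨?_, ?_⟩, ?_, ?_⟩ <;> linarith
    · have := h₂.box e he
      refine ⟨⟨?_, ?_⟩, ⟨?_, ?_⟩, ?_, ?_⟩ <;> linarith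
  · linarith
  · intro p hp
    rw [hc, List.mem_append, List.mem_cons] at hp
    rcases hp with hp | rfl | hp
    · exact h₁.first.2 p hp
    · rw [elo]; exact h₁.first.1
    · have := h₂.tent_box hp; linarith
  · intro p hp
    rw [hc, List.mem_append, List.mem_cons] at hp
    rcases hp with hp | rfl | hp
    · right; have := h₁.tent_box hp; linarith
    · right; rw [ehi]; exact h₂.first.1
    · exact h₂.out.2 p hp

theorem Block.vertex (c y : ℝ) (hy : |y| ≤ 1 / 2) :
    Block [vertexStation c y (-1) (-1)] (vertexStation c y (-1) (-1))
      (vertexStation c y (-1) (-1)) (c - 8) (c + 8) := by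
  obtain ⟨h1, h2⟩ := abs_le.1 hy
  refine ⟨⟨[], rfl⟩, ⟨[], rfl⟩, ⟨?_, by simp, by simp [consec], by simp [consec]⟩, ?_,
    ⟨?_, by simp [consec]⟩, ⟨?_, by simp [consec]⟩⟩
  · simp only [List.mem_singleton]; rintro e rfl
    exact .vertex _ _ _ _ hy (Or.inl rfl) (Or.inl rfl)
  · simp only [List.mem_singleton]; rintro e rfl
    simp only [vertexStation]
    refine ⟨⟨?_, ?_⟩, ⟨?_, ?_⟩, ?_, ?_⟩ <;> linarith
  · simp only [vertexStation]; linarith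
  · simp only [vertexStation]; linarith

theorem Block.far (c : ℝ) : Block [farStation c] (farStation c) (farStation c) (c - 8) (c + 8) := by
  refine ⟨⟨[], rfl⟩, ⟨[], rfl⟩, ⟨?_, by simp, by simp [consec], by simp [consec]⟩, ?_,
    ⟨?_, by simp [consec]⟩, ⟨?_, by simp [consec]⟩⟩
  · simp only [List.mem_singleton]; rintro e rfl
    exact .far _
  · simp only [List.mem_singleton]; rintro e rfl
    simp only [farStation]
    refine ⟨⟨?_, ?_⟩, ⟨?_, ?_⟩, ?_, ?_⟩ <;> linarith
  · simp only [farStation]; linarith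
  · simp only [farStation]; linarith

/-- The tent from `c + 8` to `d - 4` is nested in the one from `d + z + 2` back to `c + 4`. Thanks
to the dip neither covers column `c`, and the final departure foot `c - (y + 2)` stays to the left
of both. -/
theorem Block.swap (c y d z : ℝ) (hy : |y| ≤ 1 / 2) (hz : |z| ≤ 1 / 2) (hcd : c + 100 ≤ d) :
    Block [dipStation c, vertexStation d z (-1) 1, vertexStation c y 1 (-1)] (dipStation c)
      (vertexStation c y 1 (-1)) (c - 8) (d + 8) := by
  obtain ⟨h1, h2⟩ := abs_le.1 hy
  obtain ⟨h3, h4⟩ := abs_le.1 hz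
  have lo1 : tentLo (dipStation c, vertexStation d z (-1) 1) = c + 8 :=
    tentLo_right (by simp only [dipStation, vertexStation]; linarith)
  have hi1 : tentHi (dipStation c, vertexStation d z (-1) 1) = d + 4 * -1 :=
    tentHi_right (by simp only [dipStation, vertexStation]; linarith)
  have lo2 : tentLo (vertexStation d z (-1) 1, vertexStation c y 1 (-1)) = c + 4 * 1 :=
    tentLo_left (by simp only [vertexStation]; linarith)
  have hi2 : tentHi (vertexStation d z (-1) 1, vertexStation c y 1 (-1)) = d + 1 * (z + 2) :=
    tentHi_left (by simp only [vertexStation]; linarith)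
  refine ⟨⟨_, rfl⟩, ⟨[_, _], rfl⟩, ⟨?_, ?_, ?_, ?_⟩, ?_, ⟨?_, ?_⟩, ⟨?_, ?_⟩⟩
  · simp only [List.mem_cons, List.not_mem_nil, or_false]
    rintro e (rfl | rfl | rfl)
    · exact .dip _
    · exact .vertex _ _ _ _ hz (Or.inl rfl) (Or.inr rfl)
    · exact .vertex _ _ _ _ hy (Or.inr rfl) (Or.inl rfl)
  · simp only [List.pairwise_cons, List.mem_cons, List.not_mem_nil, or_false, forall_eq_or_imp,
      forall_eq]
    exact ⟨⟨Station.sep_of_lt hcd, Or.inr ⟨rfl, Or.inr ⟨rfl, rfl⟩⟩⟩, Station.sep_of_gt hcd,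
      by simp, List.Pairwise.nil⟩
  · simp only [consec, List.mem_cons, List.not_mem_nil, or_false]
    rintro p (rfl | rfl)
    · left; simp only [dipStation, vertexStation]; constructor <;> linarith
    · right; simp only [vertexStation]; constructor <;> linarith
  · simp only [consec, List.pairwise_cons, List.mem_cons, List.not_mem_nil, or_false, forall_eq]
    refine ⟨?_, by simp, List.Pairwise.nil⟩
    right; right; right; rw [lo1, hi1, lo2, hi2]; constructor <;> linarith
  · simp only [List.mem_cons, List.not_mem_nil, or_false]
    rintro e (rfl | rfl | rfl) <;> simp only [dipStation, vertexStation] <;>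
      refine ⟨⟨?_, ?_⟩, ⟨?_, ?_⟩, ?_, ?_⟩ <;> linarith
  · simp only [dipStation, vertexStation]; linarith
  · simp only [consec, List.mem_cons, List.not_mem_nil, or_false]
    rintro p (rfl | rfl)
    · rw [lo1]; simp only [dipStation]; linarith
    · rw [lo2]; simp only [dipStation]; linarith
  · simp only [vertexStation]; linarith
  · simp only [consec, List.mem_cons, List.not_mem_nil, or_false]
    rintro p (rfl | rfl)
    · left; rw [lo1]; simp only [vertexStation]; linarith
    · left; rw [lo2]; simp only [vertexStation]; linarith

/-- The intervals form a chain: `[c + 4, d + 8]` contains `[c + 8, d + 4]`, which contains `[f.arr,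
d + z + 2]`, which contains `[l.dep, d - 8]` and all interior tents. The second dip lets the path
leave the nested tents under vertex `d`, so that its outermost tent can return to column `c` over
everything. -/
theorem Block.wrap {G : List Station} {f l : Station} {a b : ℝ} (h : Block G f l a b)
    (c y d z : ℝ) (hy : |y| ≤ 1 / 2) (hz : |z| ≤ 1 / 2) (hca : c + 92 ≤ a) (hbd : b + 92 ≤ d) :
    Block (dipStation c :: vertexStation d z 1 1 :: (G ++ [dipStation d, vertexStation c y 1 (-1)]))
      (dipStation c) (vertexStation c y 1 (-1)) (c - 8) (d + 8) := by
  obtain ⟨h1, h2⟩ := abs_le.1 hy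
  obtain ⟨h3, h4⟩ := abs_le.1 hz
  obtain ⟨kf1, kf2, kf3⟩ := h.box _ h.mem_first
  obtain ⟨kl1, kl2, kl3⟩ := h.box _ h.mem_last
  have hcd : c + 100 ≤ d := by linarith
  have lo1 : tentLo (dipStation c, vertexStation d z 1 1) = c + 8 :=
    tentLo_right (by simp only [dipStation, vertexStation]; linarith)
  have hi1 : tentHi (dipStation c, vertexStation d z 1 1) = d + 4 * 1 :=
    tentHi_right (by simp only [dipStation, vertexStation]; linarith)
  have lo2 : tentLo (vertexStation d z 1 1, f) = f.arr :=
    tentLo_left (by simp only [vertexStation]; linarith)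
  have hi2 : tentHi (vertexStation d z 1 1, f) = d + 1 * (z + 2) :=
    tentHi_left (by simp only [vertexStation]; linarith)
  have lo3 : tentLo (l, dipStation d) = l.dep :=
    tentLo_right (by simp only [dipStation]; linarith)
  have hi3 : tentHi (l, dipStation d) = d - 8 :=
    tentHi_right (by simp only [dipStation]; linarith)
  have lo4 : tentLo (dipStation d, vertexStation c y 1 (-1)) = c + 4 * 1 :=
    tentLo_left (by simp only [dipStation, vertexStation]; linarith)
  have hi4 : tentHi (dipStation d, vertexStation c y 1 (-1)) = d + 8 :=
    tentHi_left (by simp only [dipStation, vertexStation]; linarith)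
  have hc : consec (dipStation c :: vertexStation d z 1 1 ::
      (G ++ [dipStation d, vertexStation c y 1 (-1)])) =
      (dipStation c, vertexStation d z 1 1) :: (vertexStation d z 1 1, f) ::
        (consec G ++ [(l, dipStation d), (dipStation d, vertexStation c y 1 (-1))]) := by
    obtain ⟨B, hB⟩ := h.head
    obtain ⟨A, hA⟩ := h.last
    have e1 : consec (G ++ [dipStation d, vertexStation c y 1 (-1)]) =
        consec G ++ [(l, dipStation d), (dipStation d, vertexStation c y 1 (-1))] := by
      rw [hA]; exact _root_.consec_append A l (dipStation d) _
    rw [← e1, hB]; rfl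
  refine ⟨⟨_, rfl⟩, ⟨dipStation c :: vertexStation d z 1 1 :: (G ++ [dipStation d]), by simp⟩,
    ⟨?_, ?_, ?_, ?_⟩, ?_, ⟨?_, ?_⟩, ⟨?_, ?_⟩⟩
  · simp only [List.mem_cons, List.mem_append, List.not_mem_nil, or_false]
    rintro e (rfl | rfl | he | rfl | rfl)
    · exact .dip _
    · exact .vertex _ _ _ _ hz (Or.inr rfl) (Or.inr rfl)
    · exact h.draw.wf e he
    · exact .dip _
    · exact .vertex _ _ _ _ hy (Or.inr rfl) (Or.inl rfl)
  · rw [List.pairwise_cons, List.pairwise_cons, List.pairwise_append]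
    simp only [List.mem_cons, List.mem_append, List.not_mem_nil, or_false]
    refine ⟨?_, ?_, h.draw.sep, ?_, ?_⟩
    · rintro e (rfl | he | rfl | rfl)
      · exact Station.sep_of_lt hcd
      · have := h.box e he
        exact Station.sep_of_lt (by simp only [dipStation]; linarith)
      · exact Station.sep_of_lt hcd
      · exact Or.inr ⟨rfl, Or.inr ⟨rfl, rfl⟩⟩
    · rintro e (he | rfl | rfl)
      · have := h.box e he
        exact Station.sep_of_gt (by simp only [vertexStation]; linarith)
      · exact Or.inr ⟨rfl, Or.inl ⟨rfl, rfl⟩⟩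
      · exact Station.sep_of_gt hcd
    · simp only [List.pairwise_cons, List.mem_cons, List.not_mem_nil, or_false, forall_eq]
      exact ⟨Station.sep_of_gt hcd, by simp, List.Pairwise.nil⟩
    · intro e he g hg
      have := h.box e he
      rcases hg with rfl | rfl
      · exact Station.sep_of_lt (by simp only [dipStation]; linarith)
      · exact Station.sep_of_gt (by simp only [vertexStation]; linarith)
  · rw [hc]
    simp only [List.mem_cons, List.mem_append, List.not_mem_nil, or_false]
    rintro p (rfl | rfl | hp | rfl | rfl)
    · left; simp only [dipStation, vertexStation]; constructor <;> linarith
    · right; simp only [vertexStation]; constructor <;> linarith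
    · exact h.draw.link p hp
    · left; exact ⟨by simp only [dipStation]; linarith, h.out.1⟩
    · right; simp only [dipStation, vertexStation]; constructor <;> linarith
  · rw [hc, List.pairwise_cons, List.pairwise_cons, List.pairwise_append]
    simp only [List.mem_cons, List.mem_append, List.not_mem_nil, or_false]
    refine ⟨?_, ?_, h.draw.nc, ?_, ?_⟩
    · rintro p (rfl | hp | rfl | rfl)
      · right; right; left; rw [lo1, hi1, lo2, hi2]; constructor <;> linarith
      · have := h.tent_box hp
        right; right; left; rw [lo1, hi1]; constructor <;> linarith
      · right; right; left; rw [lo1, hi1, lo3, hi3]; constructor <;> linarith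
      · right; right; right; rw [lo1, hi1, lo4, hi4]; constructor <;> linarith
    · rintro p (hp | rfl | rfl)
      · have := h.tent_box hp
        right; right; left; rw [lo2, hi2]; exact ⟨h.first.2 p hp, by linarith⟩
      · right; right; left; rw [lo2, hi2, lo3, hi3]; exact ⟨h.first.1, by linarith⟩
      · right; right; right; rw [lo2, hi2, lo4, hi4]; constructor <;> linarith
    · simp only [List.pairwise_cons, List.mem_cons, List.not_mem_nil, or_false, forall_eq]
      refine ⟨?_, by simp, List.Pairwise.nil⟩
      right; right; right; rw [lo3, hi3, lo4, hi4]; constructor <;> linarith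
    · intro p hp q hq
      have hb := h.tent_box hp
      rcases hq with rfl | rfl
      · rcases h.out.2 p hp with ho | ho
        · right; right; right; rw [lo3, hi3]; exact ⟨ho, by linarith⟩
        · left; rw [lo3]; exact ho
      · right; right; right; rw [lo4, hi4]; constructor <;> linarith
  · simp only [List.mem_cons, List.mem_append, List.not_mem_nil, or_false]
    rintro e (rfl | rfl | he | rfl | rfl)
    · simp only [dipStation]; refine ⟨⟨?_, ?_⟩, ⟨?_, ?_⟩, ?_, ?_⟩ <;> linarith
    · simp only [vertexStation]; refine ⟨⟨?_, ?_⟩, ⟨?_, ?_⟩, ?_, ?_⟩ <;> linarith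
    · have := h.box e he
      refine ⟨⟨?_, ?_⟩, ⟨?_, ?_⟩, ?_, ?_⟩ <;> linarith
    · simp only [dipStation]; refine ⟨⟨?_, ?_⟩, ⟨?_, ?_⟩, ?_, ?_⟩ <;> linarith
    · simp only [vertexStation]; refine ⟨⟨?_, ?_⟩, ⟨?_, ?_⟩, ?_, ?_⟩ <;> linarith
  · simp only [dipStation, vertexStation]; linarith
  · rw [hc]
    simp only [List.mem_cons, List.mem_append, List.not_mem_nil, or_false]
    rintro p (rfl | rfl | hp | rfl | rfl)
    · rw [lo1]; simp only [dipStation]; linarith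
    · rw [lo2]; simp only [dipStation]; linarith
    · have := h.tent_box hp; simp only [dipStation]; linarith
    · rw [lo3]; simp only [dipStation]; linarith
    · rw [lo4]; simp only [dipStation]; linarith
  · simp only [vertexStation]; linarith
  · rw [hc]
    simp only [List.mem_cons, List.mem_append, List.not_mem_nil, or_false]
    rintro p (rfl | rfl | hp | rfl | rfl) <;> left
    · rw [lo1]; simp only [vertexStation]; linarith
    · rw [lo2]; simp only [vertexStation]; linarith
    · have := h.tent_box hp; simp only [vertexStation]; linarith
    · rw [lo3]; simp only [vertexStation]; linarith
    · rw [lo4]; simp only [vertexStation]; linarith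

/-! ### The path that follows an arrangement -/

/-- A step of a path leads to the station of a vertex, possibly by way of a dip. -/
abbrev PathStep : Type := Option Station × Station

/-- The stations visited during a list of steps. -/
def stepStations (s : List PathStep) : List Station := s.flatMap fun p => p.1.toList ++ [p.2]

/-- The steps through an initial block whose first and last columns are `c` and `d` and whose
interior is visited by the steps `s`. -/
def wrapSteps (c y d z : ℝ) (s : List PathStep) : List PathStep :=
  match s with
  | [] => [(some (dipStation c), vertexStation d z (-1) 1), (none, vertexStation c y 1 (-1))]
  | s => (some (dipStation c), vertexStation d z 1 1) ::
      (s ++ [(some (dipStation d), vertexStation c y 1 (-1))])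

/-- The steps of the path that visits vertices at the points `(X i, Y i)` in the order given by an
arrangement. -/
def Arrangement.steps (X Y : ℕ → ℝ) : Arrangement → ℕ → List PathStep
  | .nil, _ => []
  | .pt r, k => (none, vertexStation (X k) (Y k) (-1) (-1)) :: r.steps X Y (k + 1)
  | .wrap i r, k =>
      wrapSteps (X k) (Y k) (X (k + 1 + i.size)) (Y (k + 1 + i.size)) (i.steps X Y (k + 1)) ++
        r.steps X Y (k + 2 + i.size)

theorem wrapSteps_map (c y d z : ℝ) (s : List PathStep) :
    (wrapSteps c y d z s).map (fun p => p.2.S) = (d, z) :: (s.map (fun p => p.2.S) ++ [(c, y)]) := by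
  cases s <;> simp [wrapSteps, vertexStation]

theorem Arrangement.steps_map (X Y : ℕ → ℝ) (t : Arrangement) (k : ℕ) :
    (t.steps X Y k).map (fun p => p.2.S) = (t.order k).map (fun i => (X i, Y i)) := by
  induction t generalizing k with
  | nil => rfl
  | pt r ih => simp [steps, order, ih, vertexStation]
  | wrap i r ihi ihr => simp [steps, order, wrapSteps_map, ihi, ihr]

theorem stepStations_append (s t : List PathStep) :
    stepStations (s ++ t) = stepStations s ++ stepStations t := List.flatMap_append

theorem stepStations_wrapSteps (c y d z : ℝ) (s : List PathStep) (hs : s ≠ []) :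
    stepStations (wrapSteps c y d z s) = dipStation c :: vertexStation d z 1 1 ::
      (stepStations s ++ [dipStation d, vertexStation c y 1 (-1)]) := by
  cases s with
  | nil => exact absurd rfl hs
  | cons a s => simp [wrapSteps, stepStations]

theorem Arrangement.steps_eq_nil (X Y : ℕ → ℝ) (t : Arrangement) (k : ℕ) :
    t.steps X Y k = [] ↔ t.size = 0 := by
  have h1 : (t.steps X Y k).length = (t.order k).length := by
    have := congrArg List.length (t.steps_map X Y k)
    simpa using this
  have h2 : ∀ (t : Arrangement) k, (t.order k).length = t.size := by
    intro t
    induction t with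
    | nil => intro k; rfl
    | pt r ih => intro k; simp [order, size, ih]; omega
    | wrap i r ihi ihr => intro k; simp [order, size, ihi, ihr]; omega
  rw [← List.length_eq_zero_iff, h1, h2]

/-- A block contains at least one station, so an empty interior (giving `Block.swap`) and an empty
rest are treated separately. The last column of the block has index `k + m`. -/
theorem Arrangement.steps_block (X Y : ℕ → ℝ) (hX : ∀ i j, i < j → X i + 100 ≤ X j)
    (hY : ∀ i, |Y i| ≤ 1 / 2) (t : Arrangement) (k m : ℕ) (ht : t.size = m + 1) :
    ∃ f l, Block (stepStations (t.steps X Y k)) f l (X k - 8) (X (k + m) + 8) := by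
  induction t generalizing k m with
  | nil => simp [size] at ht
  | pt r ih =>
    have hv := Block.vertex (X k) (Y k) (hY k)
    rcases Nat.eq_zero_or_pos r.size with h0 | h0
    · have := (r.steps_eq_nil X Y (k + 1)).2 h0
      obtain rfl : m = 0 := by simp only [size] at ht; omega
      exact ⟨_, _, by rw [steps, this]; exact hv⟩
    · obtain ⟨m', hm'⟩ : ∃ m', r.size = m' + 1 := ⟨r.size - 1, by omega⟩
      obtain ⟨f, l, hb⟩ := ih (k + 1) m' hm'
      refine ⟨vertexStation (X k) (Y k) (-1) (-1), l, ?_⟩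
      have e : k + m = k + 1 + m' := by simp only [size] at ht; omega
      rw [e]
      have hX' := hX k (k + 1) (by omega)
      exact hv.append hb (by linarith)
  | wrap i r ihi ihr =>
    have hw : ∃ f l, Block (stepStations (wrapSteps (X k) (Y k) (X (k + 1 + i.size))
        (Y (k + 1 + i.size)) (i.steps X Y (k + 1)))) f l (X k - 8) (X (k + 1 + i.size) + 8) := by
      rcases Nat.eq_zero_or_pos i.size with h0 | h0
      · rw [(i.steps_eq_nil X Y (k + 1)).2 h0]
        exact ⟨_, _, Block.swap _ _ _ _ (hY _) (hY _) (hX _ _ (by omega))⟩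
      · obtain ⟨m', hm'⟩ : ∃ m', i.size = m' + 1 := ⟨i.size - 1, by omega⟩
        obtain ⟨f, l, hb⟩ := ihi (k + 1) m' hm'
        rw [stepStations_wrapSteps _ _ _ _ _ (fun h => by
          rw [steps_eq_nil] at h; omega)]
        have h1 := hX k (k + 1) (by omega)
        have h2 := hX (k + 1 + m') (k + 1 + i.size) (by omega)
        exact ⟨_, _, hb.wrap _ _ _ _ (hY _) (hY _) (by linarith) (by linarith)⟩
    obtain ⟨f, l, hw⟩ := hw
    rw [steps, stepStations_append]
    rcases Nat.eq_zero_or_pos r.size with h0 | h0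
    · have := (r.steps_eq_nil X Y (k + 2 + i.size)).2 h0
      rw [this]
      have e : k + m = k + 1 + i.size := by simp only [size] at ht; omega
      rw [e]
      exact ⟨f, l, by simpa [stepStations] using hw⟩
    · obtain ⟨m', hm'⟩ : ∃ m', r.size = m' + 1 := ⟨r.size - 1, by omega⟩
      obtain ⟨f', l', hb⟩ := ihr (k + 2 + i.size) m' hm'
      refine ⟨f, l', ?_⟩
      have e : k + m = k + 2 + i.size + m' := by simp only [size] at ht; omega
      rw [e]
      have hX' := hX (k + 1 + i.size) (k + 2 + i.size) (by omega)
      exact hw.append hb (by linarith)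

/-- The edges drawn during the steps that follow a visit of the vertex station `e`. -/
noncomputable def stepEdges (e : Station) : List PathStep → List (List Plane × Plane)
  | [] => []
  | (none, v) :: s => ([apex e v, landing e v], v.S) :: stepEdges v s
  | (some d, v) :: s =>
      ([apex e d, landing e d, d.S, apex d v, landing d v], v.S) :: stepEdges v s

theorem pathCorners_stepEdges (e : Station) (s : List PathStep) :
    pathCorners e.S (stepEdges e s) = stationCorners (e :: stepStations s) := by
  induction s generalizing e with
  | nil => rfl
  | cons p s ih =>
    obtain ⟨d, v⟩ := p
    cases d with
    | none =>
      have := ih v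
      simp only [stepEdges, pathCorners, this]
      rfl
    | some d =>
      have := ih v
      simp only [stepEdges, pathCorners, this]
      rfl

/-- Source of the bound 5: apex and landing at the dip, take-off from the dip, then apex and landing
at the vertex. -/
theorem stepEdges_length_le (e : Station) (s : List PathStep) :
    ∀ x ∈ stepEdges e s, x.1.length ≤ 5 := by
  induction s generalizing e with
  | nil => simp [stepEdges]
  | cons p s ih =>
    obtain ⟨d, v⟩ := p
    intro x hx
    cases d with
    | none =>
      rcases List.mem_cons.1 hx with rfl | hx
      · simp
      · exact ih v x hx
    | some d =>
      rcases List.mem_cons.1 hx with rfl | hx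
      · simp
      · exact ih v x hx

theorem stepEdges_map (e : Station) (s : List PathStep) :
    (stepEdges e s).map Prod.snd = s.map (fun p => p.2.S) := by
  induction s generalizing e with
  | nil => rfl
  | cons p s ih =>
    obtain ⟨d, v⟩ := p
    cases d <;> simp [stepEdges, ih]

/-! ### Drawing one part of the path on one side -/

/-- Feet are within 8 of the centre, and a leg of slope 1 or -1 moves sideways by at most 4 between
heights -2 and 2, whence 12. Only this strip matters for the mirrored other half. -/
theorem Drawable.region {e : Station} {G : List Station} (h : Drawable (e :: G)) (hG : G ≠ [])
    {q : Plane} (hq : q ∈ polylineSet (stationCorners (e :: G))) :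
    -2 ≤ q.2 ∧ (q.2 ≤ 2 → ∃ g ∈ e :: G, |q.1 - g.c| ≤ 12 ∧
      (g.land = 0 → 0 ≤ q.2 ∧ (q.2 = 0 → g.c ≤ q.1 ∧ q.1 ≤ g.c + 8))) := by
  have hfar : ∀ g : Station, g.WF → g.land = 0 → g = farStation g.c := by
    intro g hg hl
    cases hg with
    | vertex c y s t hy hs ht => simp [vertexStation] at hl
    | dip c => simp [dipStation] at hl
    | far c => rfl
  rcases mem_stationCorners hq with ⟨⟨f, g⟩, hp, hp'⟩ | ⟨hG', -⟩
  swap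
  · exact absurd hG' hG
  have hm := mem_of_mem_consec hp
  have hf := h.wf f hm.1
  have hg := h.wf g (List.mem_cons_of_mem _ hm.2)
  have hl := h.link _ hp
  simp only at hp' hl
  rcases hp' with hp' | hp'
  · refine ⟨(mem_tentSet' hf hg hl hp').1, fun h2 => ?_⟩
    obtain ⟨-, c2, c3, -⟩ := hf.bounds
    obtain ⟨c1, -, -, -, c4, -⟩ := hg.bounds
    obtain ⟨c1, c1'⟩ := abs_le.1 c1
    obtain ⟨c2, c2'⟩ := abs_le.1 c2
    rcases mem_tentSet hf hg hl hp' with ⟨a1, a4, ⟨a0, a2, a3⟩ | ⟨a0, a2, a3⟩⟩ |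
        ⟨a1, a4, ⟨a0, a2, a3⟩ | ⟨a0, a2, a3⟩⟩
    · refine ⟨f, hm.1, abs_le.2 ⟨by linarith, by linarith⟩, fun h0 => ?_⟩
      rw [hfar f hf h0] at a0 a2 ⊢
      simp only [farStation] at *
      exact ⟨a0, fun _ => ⟨by linarith, by linarith⟩⟩
    · refine ⟨g, List.mem_cons_of_mem _ hm.2, abs_le.2 ⟨by linarith, by linarith⟩, fun h0 => ?_⟩
      rw [hfar g hg h0] at a0 a2 ⊢
      simp only [farStation] at *
      exact ⟨a0, fun _ => ⟨by linarith, by linarith⟩⟩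
    · refine ⟨f, hm.1, abs_le.2 ⟨by linarith, by linarith⟩, fun h0 => ?_⟩
      rw [hfar f hf h0] at a0 a2 ⊢
      simp only [farStation] at *
      exact ⟨a0, fun _ => ⟨by linarith, by linarith⟩⟩
    · refine ⟨g, List.mem_cons_of_mem _ hm.2, abs_le.2 ⟨by linarith, by linarith⟩, fun h0 => ?_⟩
      rw [hfar g hg h0] at a0 a2 ⊢
      simp only [farStation] at *
      exact ⟨a0, fun _ => ⟨by linarith, by linarith⟩⟩
  · rcases mem_groundSet hg hl hp' with ⟨l, g1, g2, g3, g4, -⟩ | ⟨l, g1, g2, g3⟩ | ⟨l, g1, g2, g3⟩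
    · exact ⟨by linarith, fun _ => ⟨g, List.mem_cons_of_mem _ hm.2,
        abs_le.2 ⟨by linarith, by linarith⟩, fun h0 => by linarith⟩⟩
    · exact ⟨by linarith, fun _ => ⟨g, List.mem_cons_of_mem _ hm.2,
        abs_le.2 ⟨by linarith, by linarith⟩, fun h0 => by linarith⟩⟩
    · exact ⟨by linarith, fun _ => ⟨g, List.mem_cons_of_mem _ hm.2,
        abs_le.2 ⟨by linarith, by linarith⟩, fun h0 => ⟨g1.ge, fun _ => ⟨g2, g3⟩⟩⟩⟩

theorem stationCorners_concat (A : List Station) (l g : Station) :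
    stationCorners (A ++ [l] ++ [g]) =
      stationCorners (A ++ [l]) ++ [apex l g, landing l g, g.S] := by
  induction A with
  | nil => rfl
  | cons a A ih =>
    cases A with
    | nil => rfl
    | cons b A => simpa [stationCorners] using ih

theorem wrapSteps_columns (c y d z : ℝ) (s : List PathStep) (e : Station)
    (he : e ∈ stepStations (wrapSteps c y d z s)) :
    (e.land ≠ 0 ∧ (e.c = c ∨ e.c = d)) ∨ e ∈ stepStations s := by
  cases s with
  | nil =>
    simp only [wrapSteps, stepStations, List.flatMap_cons, List.flatMap_nil, Option.toList_some,
      Option.toList_none, List.mem_append, List.mem_cons, List.not_mem_nil, or_false,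
      false_or] at he
    rcases he with (rfl | rfl) | rfl <;> simp [dipStation, vertexStation]
  | cons a s =>
    rw [stepStations_wrapSteps _ _ _ _ _ (by simp)] at he
    simp only [List.mem_append, List.mem_cons, List.not_mem_nil, or_false] at he
    rcases he with rfl | rfl | he | rfl | rfl
    · left; simp [dipStation]
    · left; simp [vertexStation]
    · exact Or.inr he
    · left; simp [dipStation]
    · left; simp [vertexStation]

theorem Arrangement.steps_columns (X Y : ℕ → ℝ) (t : Arrangement) (k : ℕ) (e : Station)
    (he : e ∈ stepStations (t.steps X Y k)) :
    e.land ≠ 0 ∧ ∃ i, k ≤ i ∧ i < k + t.size ∧ e.c = X i := by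
  induction t generalizing k with
  | nil => simp [steps, stepStations] at he
  | pt r ih =>
    have : stepStations (steps X Y (.pt r) k) =
      vertexStation (X k) (Y k) (-1) (-1) :: stepStations (r.steps X Y (k + 1)) := rfl
    rw [this, List.mem_cons] at he
    simp only [size]
    rcases he with rfl | he
    · exact ⟨by simp [vertexStation], k, le_rfl, by omega, rfl⟩
    · obtain ⟨h1, i, h2, h3, h4⟩ := ih _ he
      exact ⟨h1, i, by omega, by omega, h4⟩
  | wrap j r ihj ihr =>
    rw [steps, stepStations_append, List.mem_append] at he
    simp only [size]
    rcases he with he | he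
    · rcases wrapSteps_columns _ _ _ _ _ _ he with ⟨h1, h2 | h2⟩ | he
      · exact ⟨h1, k, le_rfl, by omega, h2⟩
      · exact ⟨h1, k + 1 + j.size, by omega, by omega, h2⟩
      · obtain ⟨h1, i, h2, h3, h4⟩ := ihj _ he
        exact ⟨h1, i, by omega, by omega, h4⟩
    · obtain ⟨h1, i, h2, h3, h4⟩ := ihr _ he
      exact ⟨h1, i, by omega, by omega, h4⟩

/-- The chain of the arrangement is continued to a far station and cut at its landing point on the
axis. The description of the low points is what prevents a collision with the mirrored half. -/
theorem exists_half_path (X Y : ℕ → ℝ) (hX : ∀ i j, i < j → X i + 100 ≤ X j)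
    (hY : ∀ i, |Y i| ≤ 1 / 2) (t : Arrangement) (m : ℕ) (ht : t.size = m + 1) :
    ∃ (s : Plane) (es : List (List Plane × Plane)) (T : Plane),
      s :: es.map Prod.snd = (t.order 0).map (fun i => (X i, Y i)) ∧
      (∀ e ∈ es, e.1.length ≤ 5) ∧
      IsSimplePolyline (pathCorners s es ++ [T, (X (m + 1), 0)]) ∧
      ∀ q ∈ polylineSet (pathCorners s es ++ [T, (X (m + 1), 0)]), -2 ≤ q.2 ∧
        (q.2 ≤ 2 → (∃ i ≤ m, |q.1 - X i| ≤ 12) ∨ (|q.1 - X (m + 1)| ≤ 12 ∧ 0 ≤ q.2 ∧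
          (q.2 = 0 → q = (X (m + 1), 0)))) := by
  obtain ⟨f, l, hb⟩ := t.steps_block X Y hX hY 0 m ht
  rw [zero_add] at hb
  have hm := hX m (m + 1) (by omega)
  have hb' := hb.append (Block.far (X (m + 1))) (by linarith)
  obtain ⟨p, r, hpr⟩ : ∃ p r, t.steps X Y 0 = p :: r := by
    cases h : t.steps X Y 0 with
    | nil => rw [Arrangement.steps_eq_nil] at h; omega
    | cons p r => exact ⟨p, r, rfl⟩
  -- Nothing precedes the first vertex, so a dip `d` in the first step is discarded and the path
  -- starts at `v`.
  obtain ⟨d, v⟩ := p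
  obtain ⟨A, hA⟩ : ∃ A, v :: stepStations r = A ++ [l] := by
    obtain ⟨A, hA⟩ := hb.last
    rw [hpr] at hA
    cases d with
    | none => exact ⟨A, hA⟩
    | some d =>
      cases A with
      | nil => simp [stepStations] at hA
      | cons a A => exact ⟨A, (List.cons.inj hA).2⟩
  have hD : Drawable (v :: stepStations r ++ [farStation (X (m + 1))]) := by
    have hd := hb'.draw
    rw [hpr] at hd
    cases d with
    | none => exact hd
    | some d => exact hd.tail
  have hcol : ∀ e ∈ v :: stepStations r, e.land ≠ 0 ∧ ∃ i, i ≤ m ∧ e.c = X i := by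
    intro e he
    obtain ⟨h1, i, -, h3, h4⟩ := t.steps_columns X Y 0 e (by
      rw [hpr]
      cases d with
      | none => exact he
      | some d => exact List.mem_cons_of_mem _ he)
    exact ⟨h1, i, by omega, h4⟩
  have hlm : l ∈ stepStations (t.steps X Y 0) := hb.mem_last
  have hland : landing l (farStation (X (m + 1))) = (X (m + 1), 0) := by
    have := (hb.box l hlm).2.1.2
    simp only [landing]
    rw [if_pos (by simp only [farStation]; linarith)]
    simp [farStation]
  have hcorn : stationCorners (v :: stepStations r ++ [farStation (X (m + 1))]) =
      pathCorners v.S (stepEdges v r) ++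
        [apex l (farStation (X (m + 1))), (X (m + 1), 0), (X (m + 1) + 8, 0)] := by
    rw [hA, stationCorners_concat, ← hA, pathCorners_stepEdges, hland]
    rfl
  have hsimp := hD.simple
  have hassoc : pathCorners v.S (stepEdges v r) ++
        [apex l (farStation (X (m + 1))), (X (m + 1), 0)] =
      pathCorners v.S (stepEdges v r) ++ [apex l (farStation (X (m + 1)))] ++
        [(X (m + 1), 0)] := by simp
  rw [hcorn, List.append_cons, isSimplePolyline_append] at hsimp
  obtain ⟨hs1, -, hs3⟩ := hsimp
  refine ⟨v.S, stepEdges v r, apex l (farStation (X (m + 1))), ?_, stepEdges_length_le v r, ?_, ?_⟩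
  · rw [stepEdges_map, ← t.steps_map X Y 0, hpr]; rfl
  · rw [hassoc]; exact hs1
  · intro q hq
    rw [hassoc] at hq
    have hq' : q ∈ polylineSet
        (stationCorners (v :: stepStations r ++ [farStation (X (m + 1))])) := by
      rw [hcorn, List.append_cons]
      exact mem_polylineSet_of_append_left _ hq
    obtain ⟨h1, h2⟩ := Drawable.region hD (by simp) hq'
    refine ⟨h1, fun hle => ?_⟩
    obtain ⟨g, hg, hg1, hg2⟩ := h2 hle
    have hg : g ∈ (v :: stepStations r) ++ [farStation (X (m + 1))] := hg
    rcases List.mem_append.1 hg with hg | hg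
    · obtain ⟨-, i, hi, hc⟩ := hcol g hg
      left; exact ⟨i, hi, by rw [← hc]; exact hg1⟩
    · right
      rw [List.mem_singleton] at hg
      subst hg
      obtain ⟨hg3, hg4⟩ := hg2 rfl
      -- A point of the far column at height 0 lies on the ground segment that was cut off; by
      -- simplicity the retained part meets that segment only in the landing point.
      refine ⟨hg1, hg3, fun h0 => hs3 q hq ?_⟩
      obtain ⟨h5, h6⟩ := hg4 h0
      simp only [farStation] at h5 h6
      refine Or.inl ⟨1 - (q.1 - X (m + 1)) / 8, (q.1 - X (m + 1)) / 8, by linarith, by linarith,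
        by ring, ?_⟩
      refine Prod.ext ?_ ?_
      · simp; ring
      · simp [h0]

/-! ### Joining the two parts -/

theorem pathCorners_map (f : Plane → Plane) (s : Plane) (es : List (List Plane × Plane)) :
    pathCorners (f s) (es.map fun e => (e.1.map f, f e.2)) = (pathCorners s es).map f := by
  induction es generalizing s with
  | nil => rfl
  | cons e es ih => simp [pathCorners, ih]

/-- The reflection in the horizontal axis. -/
noncomputable def mirror : Plane →ₗ[ℝ] Plane := LinearMap.prodMap LinearMap.id (-LinearMap.id)

theorem mirror_apply (q : Plane) : mirror q = (q.1, -q.2) := rfl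

theorem mirror_injective : Function.Injective mirror := by
  intro p q h
  rw [mirror_apply, mirror_apply, Prod.mk.injEq, neg_inj] at h
  exact Prod.ext h.1 h.2

theorem exists_one_sided_path (X Y : ℕ → ℝ) (hX : ∀ i j, i < j → X i + 100 ≤ X j)
    (hY : ∀ i, |Y i| ≤ 1 / 2) (t : Arrangement) (m : ℕ) (ht : t.size = m + 1) :
    ∃ (s : Plane) (es : List (List Plane × Plane)),
      s :: es.map Prod.snd = (t.order 0).map (fun i => (X i, Y i)) ∧
      (∀ e ∈ es, e.1.length ≤ 5) ∧ IsSimplePolyline (pathCorners s es) := by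
  obtain ⟨s, es, T, h1, h2, h3, -⟩ := exists_half_path X Y hX hY t m ht
  refine ⟨s, es, h1, h2, ?_⟩
  obtain ⟨l, hl⟩ := pathCorners_eq_concat s es
  rw [hl, List.append_assoc, List.singleton_append] at h3
  rw [hl]
  exact h3.left

/-- A common point has height between -2 and 2, hence lies within 12 of a column of each half.
Distinct columns are 100 apart, so both must be the far column; there one half is at height at least
0 and the other at most 0. -/
theorem exists_two_sided_path (X Y X' Y' : ℕ → ℝ) (hX : ∀ i j, i < j → X i + 100 ≤ X j)
    (hY : ∀ i, |Y i| ≤ 1 / 2) (hX' : ∀ i j, i < j → X' i + 100 ≤ X' j) (hY' : ∀ i, |Y' i| ≤ 1 / 2)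
    (t t' : Arrangement) (m m' : ℕ) (ht : t.size = m + 1) (ht' : t'.size = m' + 1)
    (hF : X (m + 1) = X' (m' + 1)) (hXX : ∀ i ≤ m, ∀ j ≤ m', 100 ≤ |X i - X' j|) :
    ∃ (s : Plane) (es : List (List Plane × Plane)),
      s :: es.map Prod.snd = (t.order 0).map (fun i => (X i, Y i)) ++
        ((t'.order 0).map (fun i => (X' i, -Y' i))).reverse ∧
      (∀ e ∈ es, e.1.length ≤ 5) ∧ IsSimplePolyline (pathCorners s es) := by
  obtain ⟨s₁, es₁, T₁, a1, a2, a3, a4⟩ := exists_half_path X Y hX hY t m ht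
  obtain ⟨s₂, es₂, T₂, b1, b2, b3, b4⟩ := exists_half_path X' Y' hX' hY' t' m' ht'
  rw [← hF] at b3 b4
  obtain ⟨s₃, es₃, c1, c2, c3⟩ := exists_reverse_path (mirror s₂)
    (es₂.map fun e => (e.1.map mirror, mirror e.2))
  rw [pathCorners_map] at c1
  have hJ : mirror (X (m + 1), 0) = (X (m + 1), 0) := by simp [mirror_apply]
  have hrev : (X (m + 1), 0) :: ([mirror T₂] ++ pathCorners s₃ es₃) =
      ((pathCorners s₂ es₂ ++ [T₂, (X (m + 1), 0)]).map mirror).reverse := by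
    rw [List.map_append, List.reverse_append, ← c1]
    simp [hJ]
  -- The joining edge has three bends: the two apexes and the common point on the axis.
  refine ⟨s₁, es₁ ++ ([T₁, (X (m + 1), 0), mirror T₂], s₃) :: es₃, ?_, ?_, ?_⟩
  · rw [List.map_append, List.map_cons, ← List.cons_append, a1, c2]
    congr 2
    have := congrArg (List.map mirror) b1
    simp only [List.map_cons, List.map_map] at this ⊢
    exact this
  · intro e he
    rw [List.mem_append, List.mem_cons] at he
    rcases he with he | rfl | he
    · exact a2 e he
    · simp
    · have h1 : e.1.length ∈ es₃.map (fun e => e.1.length) := List.mem_map_of_mem he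
      rw [c3, List.mem_reverse, List.mem_map] at h1
      obtain ⟨g, hg, hg'⟩ := h1
      rw [List.mem_map] at hg
      obtain ⟨g', hg1, rfl⟩ := hg
      rw [← hg']
      simpa using b2 g' hg1
  · have hsplit : pathCorners s₁ (es₁ ++ ([T₁, (X (m + 1), 0), mirror T₂], s₃) :: es₃) =
        (pathCorners s₁ es₁ ++ [T₁]) ++ (X (m + 1), 0) :: ([mirror T₂] ++ pathCorners s₃ es₃) := by
      rw [pathCorners_append]; simp
    have hassoc : pathCorners s₁ es₁ ++ [T₁] ++ [((X (m + 1), 0) : Plane)] =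
        pathCorners s₁ es₁ ++ [T₁, (X (m + 1), 0)] := by simp
    rw [hsplit, isSimplePolyline_append, hrev, hassoc]
    refine ⟨a3, (b3.map mirror mirror_injective).reverse, fun q hq hq' => ?_⟩
    rw [polylineSet_reverse, polylineSet_map] at hq'
    obtain ⟨r, hr, rfl⟩ := hq'
    obtain ⟨p1, p2⟩ := a4 _ hq
    obtain ⟨r1, r2⟩ := b4 r hr
    simp only [mirror_apply] at p1 p2 ⊢
    have p3 := p2 (by linarith)
    have r3 := r2 (by linarith)
    rcases p3 with ⟨i, hi, p3⟩ | ⟨p3, p4, p5⟩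
    · exfalso
      obtain ⟨p3, p3'⟩ := abs_le.1 p3
      rcases r3 with ⟨j, hj, r3⟩ | ⟨r3, -, -⟩
      · obtain ⟨r3, r3'⟩ := abs_le.1 r3
        rcases le_abs.1 (hXX i hi j hj) with h | h <;> linarith
      · obtain ⟨r3, r3'⟩ := abs_le.1 r3
        have := hX i (m + 1) (by omega)
        linarith
    · rcases r3 with ⟨j, hj, r3⟩ | ⟨-, r4, -⟩
      · exfalso
        obtain ⟨p3, p3'⟩ := abs_le.1 p3
        obtain ⟨r3, r3'⟩ := abs_le.1 r3
        have := hX' j (m' + 1) (by omega)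
        rw [← hF] at this
        linarith
      · exact p5 (by linarith)

/-! ### Normalising the point set -/

theorem exists_normalization (S : Finset Plane) :
    ∃ φ : Plane ≃ₗ[ℝ] Plane, (∀ p ∈ S, |(φ p).2| ≤ 1 / 2) ∧
      ∀ p ∈ S, ∀ q ∈ S, p ≠ q → 100 ≤ |(φ p).1 - (φ q).1| := by
  -- The shear factor avoids the finitely many values that would give two points the same abscissa.
  -- Pairs of equal ordinate contribute a harmless 0.
  obtain ⟨ε, hε⟩ := Infinite.exists_notMem_finset
    ((S ×ˢ S).image fun r : Plane × Plane => -(r.1.1 - r.2.1) / (r.1.2 - r.2.2))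
  let d : Plane × Plane → ℝ := fun r => |(r.1.1 + ε * r.1.2) - (r.2.1 + ε * r.2.2)|
  have hd : ∀ p ∈ S, ∀ q ∈ S, p ≠ q → 0 < d (p, q) := by
    intro p hp q hq hpq
    refine abs_pos.2 fun h0 => ?_
    simp only at h0
    by_cases h2 : p.2 = q.2
    · rw [h2] at h0
      exact hpq (Prod.ext (by linarith) h2)
    · refine hε (Finset.mem_image.2 ⟨(p, q), Finset.mem_product.2 ⟨hp, hq⟩, ?_⟩)
      have h3 : p.2 - q.2 ≠ 0 := sub_ne_zero.2 h2
      simp only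
      rw [div_eq_iff h3]
      linarith
  -- Sums replace maxima over a possibly empty set; diagonal pairs contribute `100 / 0 = 0`.
  let M : ℝ := 1 + ∑ r ∈ S ×ˢ S, 100 / d r
  let μ : ℝ := 1 + ∑ p ∈ S, 2 * |p.2|
  have hM : 0 < M := by
    have : 0 ≤ ∑ r ∈ S ×ˢ S, 100 / d r := Finset.sum_nonneg fun r _ => by positivity
    simp only [M]; linarith
  have hμ : 0 < μ := by
    have : 0 ≤ ∑ p ∈ S, 2 * |p.2| := Finset.sum_nonneg fun r _ => by positivity
    simp only [μ]; linarith
  refine ⟨{ toFun := fun p => (M * (p.1 + ε * p.2), p.2 / μ)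
            map_add' := fun p q => by ext <;> simp <;> ring
            map_smul' := fun c p => by ext <;> simp <;> ring
            invFun := fun p => (p.1 / M - ε * (μ * p.2), μ * p.2)
            left_inv := fun p => by ext <;> (simp; field_simp) <;> ring
            right_inv := fun p => by ext <;> (simp; field_simp) }, ?_, ?_⟩
  · intro p hp
    change |p.2 / μ| ≤ 1 / 2
    rw [abs_div, abs_of_pos hμ, div_le_iff₀ hμ]
    have : 2 * |p.2| ≤ ∑ p ∈ S, 2 * |p.2| :=
      Finset.single_le_sum (f := fun p : Plane => 2 * |p.2|) (fun r _ => by positivity) hp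
    simp only [μ]; linarith
  · intro p hp q hq hpq
    change 100 ≤ |M * (p.1 + ε * p.2) - M * (q.1 + ε * q.2)|
    rw [← mul_sub, abs_mul, abs_of_pos hM]
    change 100 ≤ M * d (p, q)
    rw [← div_le_iff₀ (hd p hp q hq hpq)]
    have : 100 / d (p, q) ≤ ∑ r ∈ S ×ˢ S, 100 / d r :=
      Finset.single_le_sum (f := fun r => 100 / d r) (fun r _ => by positivity)
        (Finset.mem_product.2 ⟨hp, hq⟩)
    simp only [M]; linarith

theorem exists_columns (φ : Plane ≃ₗ[ℝ] Plane) (T : Finset Plane)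
    (h2 : ∀ p ∈ T, |(φ p).2| ≤ 1 / 2)
    (h1 : ∀ p ∈ T, ∀ q ∈ T, p ≠ q → 100 ≤ |(φ p).1 - (φ q).1|)
    (F : ℝ) (hF : ∀ p ∈ T, (φ p).1 + 100 ≤ F) :
    ∃ (P : ℕ → Plane) (X Y : ℕ → ℝ), (∀ i < T.card, P i ∈ T ∧ φ (P i) = (X i, Y i)) ∧
      T.val = ((List.range T.card).map P : List Plane) ∧ X T.card = F ∧
      (∀ i j, i < j → X i + 100 ≤ X j) ∧ ∀ i, |Y i| ≤ 1 / 2 := by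
  have hinj : Set.InjOn (fun p => (φ p).1) (T : Set Plane) := by
    intro p hp q hq h
    by_contra hne
    have := h1 p hp q hq hne
    simp only at h
    rw [h, sub_self, abs_zero] at this
    linarith
  have hcard : (T.image fun p => (φ p).1).card = T.card := Finset.card_image_of_injOn hinj
  let o := (T.image fun p => (φ p).1).orderEmbOfFin hcard
  have ho : ∀ i, ∃ p ∈ T, (φ p).1 = o i := fun i =>
    Finset.mem_image.1 (Finset.orderEmbOfFin_mem _ hcard i)
  choose Q hQ hQ' using ho
  let P : ℕ → Plane := fun i => if h : i < T.card then Q ⟨i, h⟩ else 0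
  -- Beyond the points the columns continue in steps of 100 from `F`: index `T.card` is the far
  -- column, the same for both halves, and the spacing holds for all indices.
  let X : ℕ → ℝ := fun i => if i < T.card then (φ (P i)).1 else F + 100 * ((i : ℝ) - T.card)
  let Y : ℕ → ℝ := fun i => if i < T.card then (φ (P i)).2 else 0
  have hP : ∀ i (h : i < T.card), P i = Q ⟨i, h⟩ := fun i h => dif_pos h
  have hPT : ∀ i < T.card, P i ∈ T := fun i h => by rw [hP i h]; exact hQ _
  have hlt : ∀ i j, i < j → j < T.card → (φ (P i)).1 < (φ (P j)).1 := by
    intro i j hij hj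
    rw [hP i (by omega), hP j hj, hQ', hQ']
    exact o.strictMono hij
  refine ⟨P, X, Y, fun i hi => ⟨hPT i hi, ?_⟩, ?_, ?_, ?_, ?_⟩
  · simp only [X, Y, if_pos hi]
  · have hPinj : Set.InjOn P (Finset.range T.card : Set ℕ) := by
      intro i hi j hj h
      rw [Finset.coe_range, Set.mem_Iio] at hi hj
      by_contra hne
      rcases Nat.lt_or_gt_of_ne hne with h' | h'
      · have := hlt i j h' hj; rw [h] at this; exact lt_irrefl _ this
      · have := hlt j i h' hi; rw [h] at this; exact lt_irrefl _ this
    have : (Finset.range T.card).image P = T := by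
      refine Finset.eq_of_subset_of_card_le ?_ ?_
      · intro p hp
        obtain ⟨i, hi, rfl⟩ := Finset.mem_image.1 hp
        exact hPT i (Finset.mem_range.1 hi)
      · rw [Finset.card_image_of_injOn hPinj, Finset.card_range]
    have h3 := Finset.image_val_of_injOn hPinj
    rw [this] at h3
    rw [h3]
    rfl
  · simp [X]
  · intro i j hij
    simp only [X]
    by_cases hj : j < T.card
    · rw [if_pos hj, if_pos (by omega)]
      have h3 := hlt i j hij hj
      have h4 := h1 _ (hPT j hj) _ (hPT i (by omega)) (fun h => by rw [h] at h3; exact lt_irrefl _ h3)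
      rw [abs_of_pos (by linarith)] at h4
      linarith
    · rw [if_neg hj]
      have hj' : (T.card : ℝ) ≤ j := by exact_mod_cast not_lt.1 hj
      by_cases hi : i < T.card
      · rw [if_pos hi]
        have := hF _ (hPT i hi)
        linarith
      · rw [if_neg hi]
        have : (i : ℝ) + 1 ≤ j := by exact_mod_cast hij
        linarith
  · intro i
    simp only [Y]
    split_ifs with hi
    · exact h2 _ (hPT i hi)
    · norm_num

/-! ### Colors -/

/-- Testing equality with one of the two colors is injective on `A`, so a match of Boolean words is
a match of color words. -/
theorem exists_arrangement_of_colors {κ : Type*} [DecidableEq κ] (A : Finset κ) (hA : A.card = 2)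
    (c : ℕ → κ) (w : List κ) (hw : ∀ x ∈ w, x ∈ A)
    (hp : w.Perm ((List.range w.length).map c)) :
    ∃ t : Arrangement, t.size = w.length ∧ (t.order 0).map c = w := by
  obtain ⟨a, b, hab, rfl⟩ := Finset.card_eq_two.1 hA
  have hb : ∀ x ∈ ({a, b} : Finset κ), ∀ y ∈ ({a, b} : Finset κ),
      decide (x = a) = decide (y = a) → x = y := by
    intro x hx y hy h
    simp only [Finset.mem_insert, Finset.mem_singleton] at hx hy
    rcases hx with rfl | rfl <;> rcases hy with rfl | rfl <;> simp_all
  obtain ⟨t, h1, h2⟩ := exists_arrangement (fun i => decide (c i = a)) _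
    (w.map fun x => decide (x = a)) rfl 0 (by
      intro x
      rw [List.length_map, (hp.map _).count_eq, List.map_map, List.range_eq_range']
      rfl)
  rw [List.length_map] at h1
  refine ⟨t, h1, ?_⟩
  have hlen : ((t.order 0).map c).length = w.length := by
    have := congrArg List.length h2
    simpa using this
  refine List.ext_getElem hlen fun i hi hi' => ?_
  refine hb _ ?_ _ (hw _ (List.getElem_mem _)) ?_
  · have hi₂ : i < (t.order 0).length := by simpa using hi
    rw [List.getElem_map]
    have hm := (t.mem_order 0 _ (List.getElem_mem hi₂)).2
    rw [zero_add, h1] at hm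
    exact hw _ (hp.mem_iff.2 (List.mem_map_of_mem (List.mem_range.2 hm)))
  · have h3 := congrArg (fun l => l[i]?) h2
    simp only [List.getElem?_map] at h3
    rw [List.length_map] at hi
    simpa [hi, hi'] using h3

/-- The color of a point of a colored point set, and a default value elsewhere. -/
noncomputable def ColoredPointSet.colorAt (S : ColoredPointSet 4) (p : Plane) : Fin 4 :=
  if h : p ∈ S.points then S.color ⟨p, h⟩ else 0

/-- As an equality of multisets, compatibility can be filtered by a set of colors, which splits it
between the two parts of the path. -/
theorem ColoredPointSet.IsCompatible.coe_ofFn {n : ℕ} {col : Fin n → Fin 4}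
    {S : ColoredPointSet 4} (hS : S.IsCompatible col) :
    ((List.ofFn col : List (Fin 4)) : Multiset (Fin 4)) = S.points.val.map S.colorAt := by
  have h1 : S.points.val.map S.colorAt = S.points.attach.val.map S.color := by
    have : S.points.val = S.points.attach.val.map Subtype.val := by
      rw [Finset.attach_val, Multiset.attach_map_val]
    rw [this, Multiset.map_map]
    refine Multiset.map_congr rfl fun p _ => ?_
    simp [colorAt]
  have h2 : ((List.ofFn col : List (Fin 4)) : Multiset (Fin 4)) =
      (Finset.univ : Finset (Fin n)).val.map col := by
    rw [List.ofFn_eq_map, ← Multiset.map_coe]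
    rfl
  rw [h1, h2]
  ext a
  rw [Multiset.count_map, Multiset.count_map]
  have := hS a
  rw [Finset.univ_eq_attach] at this
  simpa only [eq_comm (a := a), Finset.card_def, Finset.filter_val] using this

/-- The inverse of the normalising map carries segments to segments and is injective, so the
polyline can be pulled back with its bends. -/
theorem exists_embedding_of_path {n : ℕ} (col : Fin n → Fin 4) (S : ColoredPointSet 4)
    (φ : Plane ≃ₗ[ℝ] Plane) (L : List Plane) (hL : ∀ p ∈ L, p ∈ S.points)
    (hc : L.map S.colorAt = List.ofFn col) (s : Plane) (es : List (List Plane × Plane))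
    (hes : s :: es.map Prod.snd = L.map φ) (hb : ∀ e ∈ es, e.1.length ≤ 5)
    (hs : IsSimplePolyline (pathCorners s es)) :
    ∃ D : PolylineDrawing (SimpleGraph.pathGraph n),
      D.IsColoredPointSetEmbedding col S ∧ D.curveComplexity ≤ 5 := by
  have hlen : L.length = n := by simpa using congrArg List.length hc
  have hL' : φ.symm s :: (es.map fun e => (e.1.map φ.symm, φ.symm e.2)).map Prod.snd = L := by
    have := congrArg (List.map φ.symm) hes
    simp only [List.map_cons, List.map_map] at this
    have hid : (⇑φ.symm ∘ ⇑φ) = id := by funext x; simp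
    rw [hid, List.map_id] at this
    rw [List.map_map]
    exact this
  have hs' : IsSimplePolyline (pathCorners (φ.symm s)
      (es.map fun e => (e.1.map φ.symm, φ.symm e.2))) := by
    rw [pathCorners_map]
    exact hs.map φ.symm.toLinearMap φ.symm.injective
  obtain ⟨D, h1, h2⟩ := exists_drawing_of_path (n := n) _ _
    (by rw [← hlen, ← hL']; simp) hs' (by
      intro e he
      obtain ⟨e', he', rfl⟩ := List.mem_map.1 he
      simpa using hb e' he')
  refine ⟨D, fun v => ?_, h2⟩
  have hv : (v : ℕ) < L.length := by rw [hlen]; exact v.2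
  have hpos : D.pos v = L[(v : ℕ)] := by
    rw [h1, pathVertex, hL', List.getD_eq_getElem _ _ hv]
  have hmem : D.pos v ∈ S.points := by rw [hpos]; exact hL _ (List.getElem_mem hv)
  refine ⟨hmem, ?_⟩
  have h3 : S.colorAt (D.pos v) = col v := by
    have h4 : (L.map S.colorAt)[(v : ℕ)]'(by simpa using hv) = col v := by
      simp [hc]
    rw [List.getElem_map] at h4
    rw [hpos, h4]
  rw [← h3, ColoredPointSet.colorAt, dif_pos hmem]

theorem mainTheorem6 (n h : ℕ) (hh : 2 ≤ h) (hn : h ≤ n)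
    (col : Fin n → Fin 4) (A : Finset (Fin 4)) (hA : A.card = 2)
    (hfirst : ∀ i : Fin n, (i : ℕ) < h → col i ∈ A)
    (hrest : ∀ i : Fin n, h ≤ (i : ℕ) → col i ∉ A)
    (S : ColoredPointSet 4) (hS : S.IsCompatible col) :
    ∃ D : PolylineDrawing (SimpleGraph.pathGraph n),
      D.IsColoredPointSetEmbedding col S ∧ D.curveComplexity ≤ 5 := by
  obtain ⟨φ, hφ2, hφ1⟩ := exists_normalization S.points
  obtain ⟨F, hF⟩ := (S.points.image fun p => (φ p).1 + 100).exists_le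
  have hF : ∀ p ∈ S.points, (φ p).1 + 100 ≤ F := fun p hp => hF _ (Finset.mem_image_of_mem _ hp)
  set w := List.ofFn col with hw
  have hwS := hS.coe_ofFn
  have hwlen : w.length = n := by simp [w]
  have htake : ∀ x ∈ w.take h, x ∈ A := by
    intro x hx
    obtain ⟨i, hi, rfl⟩ := List.mem_iff_getElem.1 hx
    have hi' : i < h ∧ i < n := by simpa [hwlen] using hi
    rw [List.getElem_take]
    simpa [w] using hfirst ⟨i, hi'.2⟩ hi'.1
  have hdrop : ∀ x ∈ w.drop h, x ∈ Aᶜ := by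
    intro x hx
    obtain ⟨i, hi, rfl⟩ := List.mem_iff_getElem.1 hx
    have hi' : i < n - h := by simpa [hwlen] using hi
    rw [List.getElem_drop, Finset.mem_compl]
    simpa [w] using hrest ⟨h + i, by omega⟩ (by simp)
  -- One statement for both parts. The rearrangement `u'` is needed because the second part is drawn
  -- from its last vertex, with its color word reversed.
  have hpart : ∀ (B : Finset (Fin 4)) (u : List (Fin 4)), B.card = 2 → (∀ x ∈ u, x ∈ B) →
      w.filter (· ∈ B) = u → ∀ u' : List (Fin 4), u'.Perm u → ∃ (P : ℕ → Plane) (X Y : ℕ → ℝ)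
        (t : Arrangement), t.size = u.length ∧ (∀ i < u.length, P i ∈ S.points ∧
          S.colorAt (P i) ∈ B ∧ φ (P i) = (X i, Y i)) ∧ X u.length = F ∧
        (∀ i j, i < j → X i + 100 ≤ X j) ∧ (∀ i, |Y i| ≤ 1 / 2) ∧
        ((t.order 0).map P).map S.colorAt = u' := by
    intro B u hB hu hwu u' hu'
    let T := S.points.filter fun p => S.colorAt p ∈ B
    have hTS : ∀ p ∈ T, p ∈ S.points := fun p hp => (Finset.mem_filter.1 hp).1
    obtain ⟨P, X, Y, p1, p2, p3, p4, p5⟩ := exists_columns φ T (fun p hp => hφ2 p (hTS p hp))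
      (fun p hp q hq => hφ1 p (hTS p hp) q (hTS q hq)) F (fun p hp => hF p (hTS p hp))
    have hTu : T.val.map S.colorAt = (u : Multiset (Fin 4)) := by
      rw [← hwu, ← Multiset.filter_coe, hwS, Multiset.filter_map]
      rfl
    have hTcard : T.card = u.length := by
      have := congrArg Multiset.card hTu
      simpa using this
    rw [hTcard] at p1 p2 p3
    have hperm : u.Perm ((List.range u.length).map fun i => S.colorAt (P i)) := by
      rw [← Multiset.coe_eq_coe, ← hTu, p2, Multiset.map_coe, List.map_map]
      rfl
    obtain ⟨t, t1, t2⟩ := exists_arrangement_of_colors B hB (fun i => S.colorAt (P i)) u'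
      (fun x hx => hu x (hu'.mem_iff.1 hx)) (by rw [hu'.length_eq]; exact hu'.trans hperm)
    rw [hu'.length_eq] at t1
    refine ⟨P, X, Y, t, t1, fun i hi => ?_, p3, p4, p5, by rw [List.map_map]; exact t2⟩
    obtain ⟨q1, q2⟩ := p1 i hi
    exact ⟨hTS _ q1, (Finset.mem_filter.1 q1).2, q2⟩
  have hf1 : w.filter (· ∈ A) = w.take h := by
    conv_lhs => rw [← List.take_append_drop h w]
    rw [List.filter_append, List.filter_eq_self.2 (by simpa using htake),
      List.filter_eq_nil_iff.2 (by simpa using hdrop), List.append_nil]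
  have hf2 : w.filter (· ∈ Aᶜ) = w.drop h := by
    conv_lhs => rw [← List.take_append_drop h w]
    rw [List.filter_append, List.filter_eq_nil_iff.2 (by simpa using htake), List.nil_append,
      List.filter_eq_self.2 (by simpa using hdrop)]
  have hl1 : (w.take h).length = h := by simp [hwlen, hn]
  have hl2 : (w.drop h).length = n - h := by simp [hwlen]
  obtain ⟨P, X, Y, t, a1, a2, a3, a4, a5, a6⟩ :=
    hpart A (w.take h) hA htake hf1 (w.take h) (List.Perm.refl _)
  rw [hl1] at a1 a2 a3
  obtain ⟨m, rfl⟩ : ∃ m, h = m + 1 := ⟨h - 1, by omega⟩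
  have hmap : (t.order 0).map (fun i => (X i, Y i)) = ((t.order 0).map P).map φ := by
    rw [List.map_map]
    refine List.map_congr_left fun i hi => ?_
    have := (t.mem_order 0 i hi).2
    exact (a2 i (by omega)).2.2.symm
  have hmem : ∀ p ∈ (t.order 0).map P, p ∈ S.points := by
    intro p hp
    obtain ⟨i, hi, rfl⟩ := List.mem_map.1 hp
    have := (t.mem_order 0 i hi).2
    exact (a2 i (by omega)).1
  -- If the first part is the whole path, there is nothing to join.
  rcases Nat.eq_or_lt_of_le hn with hn' | hn'
  · obtain ⟨s, es, c1, c2, c3⟩ := exists_one_sided_path X Y a4 a5 t m a1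
    refine exists_embedding_of_path col S φ _ hmem ?_ s es (c1.trans hmap) c2 c3
    rw [a6, List.take_of_length_le (by omega)]
  · obtain ⟨P', X', Y', t', b1, b2, b3, b4, b5, b6⟩ :=
      hpart Aᶜ (w.drop (m + 1)) (by rw [Finset.card_compl, hA]; rfl) hdrop hf2
        (w.drop (m + 1)).reverse (List.reverse_perm _)
    rw [hl2] at b1 b2 b3
    obtain ⟨m', hm'⟩ : ∃ m', n - (m + 1) = m' + 1 := ⟨n - (m + 1) - 1, by omega⟩
    rw [hm'] at b1 b2 b3
    -- The ordinates are negated beforehand because the second half will be mirrored.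
    obtain ⟨s, es, c1, c2, c3⟩ := exists_two_sided_path X Y X' (fun i => -Y' i) a4 a5 b4
      (fun i => by rw [abs_neg]; exact b5 i) t t' m m' a1 b1 (a3.trans b3.symm) (by
        intro i hi j hj
        obtain ⟨i1, i2, i3⟩ := a2 i (by omega)
        obtain ⟨j1, j2, j3⟩ := b2 j (by omega)
        have := hφ1 _ i1 _ j1 (fun e => by rw [e] at i2; exact Finset.mem_compl.1 j2 i2)
        rwa [i3, j3] at this)
    refine exists_embedding_of_path col S φ ((t.order 0).map P ++ ((t'.order 0).map P').reverse)
      ?_ ?_ s es (c1.trans ?_) c2 c3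
    · intro p hp
      rcases List.mem_append.1 hp with hp | hp
      · exact hmem p hp
      · obtain ⟨i, hi, rfl⟩ := List.mem_map.1 (List.mem_reverse.1 hp)
        have := (t'.mem_order 0 i hi).2
        exact (b2 i (by omega)).1
    · rw [List.map_append, List.map_reverse, a6, b6, List.reverse_reverse,
        List.take_append_drop]
    · rw [List.map_append, List.map_reverse, hmap]
      congr 2
      rw [List.map_map]
      refine List.map_congr_left fun i hi => ?_
      have := (t'.mem_order 0 i hi).2
      simp only [neg_neg]
      exact (b2 i (by omega)).2.2.symm
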